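/- Let $M$ be a finite von Neumann algebra acting on a complex Hilbert space $H$, let $Z$ be a von Neumann subalgebra of the center $Z(M)$, and let $N$ be a von Neumann subalgebra of $M$ with $Z\subseteq N$ (all subalgebras contain the identity of $H$). Let $\Phi$ be a faithful normal trace on $M$ associated with $Z$, whose values are taken in one of the following: (A) $L=Z$; or (B) $L=L^0(\Omega,\Sigma,m)$, the algebra of a.e.-classes of complex measurable functions on a measure space $(\Omega,\Sigma,m)$ such that $Z$ is identified with $L^\infty(\Omega,\Sigma,m)\subseteq L$ by a $*$-isomorphism. That is, $\Phi:M\to L$ is $Z$-linear; $\Phi(x^*x)=\Phi(xx^*)\ge 0$ for all $x\in M$; $\Phi(x^*x)=0$ implies $x=0$; and $\Phi(x_\alpha)\uparrow\Phi(x)$ whenever $x_\alpha\uparrow x$ in the self-adjoint part $M_{sa}$. Since $Z\subseteq N$, the restriction of $\Phi$ to $N$ is again such a trace associated with $Z$. Then there exists a unique linear map $\mathcal{E}:M\to N$ that satisfies all of the following conditions: (i) $\mathcal{E}$ is a normal positive contraction of $M$ onto $N$, where normal means that $x_\alpha\uparrow x$ in $M_{sa}$ implies $\mathcal{E}(x_\alpha)\uparrow\mathcal{E}(x)$,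 and contraction means $\|\mathcal{E}(x)\|\le\|x\|$ in the operator norm; (ii) $\mathcal{E}(axb)=a\,\mathcal{E}(x)\,b$ for all $x\in M$ and $a,b\in N$; (iii) $\Phi(\mathcal{E}(x))=\Phi(x)$ for all $x\in M$. -/

import Mathlib

open MeasureTheory
open scoped ENNReal ComplexOrder

namespace VonNeumannAlgebra

variable {H : Type*} [NormedAddCommGroup H] [InnerProductSpace ℂ H] [CompleteSpace H]

/-- A von Neumann algebra is closed under complex scalars, so that its elements form a complex
`*`-algebra. -/
instance instSMulMemClassComplex : SMulMemClass (VonNeumannAlgebra H) ℂ (H →L[ℂ] H) where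
  smul_mem {S} c _ hx := S.toStarSubalgebra.smul_mem hx c

/-- The inclusion of a von Neumann algebra into a larger one. -/
def incl {N M : VonNeumannAlgebra H} (h : N ≤ M) (a : N) : M := ⟨(a : H →L[ℂ] H), h a.2⟩

/-- `M` is finite: its unit is a finite projection, that is, every isometry in `M` is unitary. -/
def IsFinite (M : VonNeumannAlgebra H) : Prop :=
  ∀ v : M, star v * v = 1 → v * star v = 1

/-- A map is normal if `x_α ↑ x` implies `T x_α ↑ T x` for increasing nets of self-adjoint
elements. An increasing net is given here by the directed set of its values. -/
def IsNormalMap {A B : Type*} [Star A] [Preorder A] [Preorder B] (T : A → B) : Prop :=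
  ∀ (D : Set A) (x : A), D.Nonempty → DirectedOn (· ≤ ·) D → (∀ y ∈ D, IsSelfAdjoint y) →
    IsLUB D x → IsLUB (T '' D) (T x)

/-- `Φ : M → L` is a faithful normal trace associated with the subalgebra `Z` of `M`. The values
lie in `L`, which is either `Z` itself (with `π` the identity) or an algebra `L⁰(Ω, m)` that
contains `Z = L^∞(Ω, m)` (with `π` the embedding of `Z`). -/
structure IsFaithfulNormalTrace {M Z : VonNeumannAlgebra H} (hZM : Z ≤ M)
    {L : Type*} [AddCommGroup L] [Module ℂ L] [Mul L] [PartialOrder L]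
    (π : Z →ₗ[ℂ] L) (Φ : M →ₗ[ℂ] L) : Prop where
  map_central_mul : ∀ (z : Z) (x : M), Φ (incl hZM z * x) = π z * Φ x
  map_star_mul : ∀ x : M, Φ (star x * x) = Φ (x * star x)
  nonneg : ∀ x : M, 0 ≤ Φ (star x * x)
  faithful : ∀ x : M, Φ (star x * x) = 0 → x = 0
  normal : IsNormalMap Φ

/-- `π` identifies the von Neumann algebra `Z` with `L^∞(Ω, m)`: it is an injective unital
`*`-homomorphism of `Z` into the `*`-algebra `L⁰(Ω, m)` of classes of measurable functions, and its
image consists of the classes of essentially bounded functions. -/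
structure IsLInftyIdentification {Z : VonNeumannAlgebra H} {Ω : Type*} [MeasurableSpace Ω]
    {m : Measure Ω} (π : Z →ₗ[ℂ] (Ω →ₘ[m] ℂ)) : Prop where
  map_one : π 1 = 1
  map_mul : ∀ a b : Z, π (a * b) = π a * π b
  map_star : ∀ a : Z, π (star a) = star (π a)
  injective : Function.Injective π
  mem_range_iff : ∀ f : Ω →ₘ[m] ℂ, (∃ a : Z, π a = f) ↔ eLpNorm f ∞ m < ∞

/-- `E` is a conditional expectation of `M` onto `N` that preserves `Φ`. -/
structure IsConditionalExpectation {M N : VonNeumannAlgebra H} (hNM : N ≤ M)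
    {L : Type*} [AddCommGroup L] [Module ℂ L] (Φ : M →ₗ[ℂ] L) (E : M →ₗ[ℂ] N) : Prop where
  normal : IsNormalMap E
  nonneg : ∀ x : M, 0 ≤ x → 0 ≤ E x
  contraction : ∀ x : M, ‖(E x : H →L[ℂ] H)‖ ≤ ‖(x : H →L[ℂ] H)‖
  surjective : Function.Surjective E
  bimodular : ∀ (a b : N) (x : M), E (incl hNM a * x * incl hNM b) = a * E x * b
  trace_preserving : ∀ x : M, Φ (incl hNM (E x)) = Φ x

end VonNeumannAlgebra

/-! Suppose first that `Φ` takes values in `Z`. Then `E x` is the orthogonal projection of `x` to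
`N` for the `Z`-valued inner product given by `Φ`: the element `b` of `N` with `Φ ((x - b) * c) = 0`
for all `c` in `N`. Faithfulness makes `b` unique (`eq_of_apply_sub_mul_eq_zero`), and every
conditional expectation satisfies these equations, so only existence is hard: the projection must be
a bounded operator in `N`, not just a point of a Hilbert space completion.

Let `0 ≤ x ≤ 1`. For finitely many vectors `ξ`, the sum `τ` of the functionals `⟪ξ, Φ(·) ξ⟫` is a
normal positive scalar trace. Normality implies weak continuity on bounded sets
(`isWeaklyContinuous_of_isNormalMap`), and operator intervals of `N` are weakly compact, so `τ ((x -
b) ^ 2)` attains its minimum on such an interval. The minimizer can be moved into `[0, 1]`, and the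
first variation there gives `τ ((x - b) * c) = 0`. Since `Z ⊆ N`, testing with `c * star d`, where
`d = Φ ((x - b) * c)`, gives `d ξ = 0` for the chosen `ξ`. A weak limit over finite sets of vectors
gives `d = 0`.

Measurable values reduce to this case: multiplication by `1 / (1 + |Φ 1|)` makes all values of `Φ`
bounded and changes no equality between them. -/

namespace VonNeumannAlgebra
-- Square roots and order in a von Neumann algebra
section Structure
variable {H : Type*} [NormedAddCommGroup H] [InnerProductSpace ℂ H] [CompleteSpace H]
  (M : VonNeumannAlgebra H)

theorem isClosed_coe : IsClosed (M : Set (H →L[ℂ] H)) := by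
  rw [← M.centralizer_centralizer]
  exact Set.isClosed_centralizer _

/-- A von Neumann algebra is a C⋆-algebra. -/
noncomputable abbrev cstarAlgebra : CStarAlgebra M :=
  haveI : IsClosed (M : Set (H →L[ℂ] H)) := M.isClosed_coe
  StarSubalgebra.cstarAlgebra M

instance continuousFunctionalCalculus :
    ContinuousFunctionalCalculus ℝ M IsSelfAdjoint :=
  letI := M.cstarAlgebra
  inferInstance

variable {M}

theorem mem_of_commute {x : H →L[ℂ] H} (h : ∀ y ∈ M.commutant, Commute x y) : x ∈ M := by
  rw [← M.commutant_commutant, mem_commutant_iff]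
  exact fun g hg => (h g hg).symm.eq

theorem commute_of_mem {x y : H →L[ℂ] H} (hx : x ∈ M) (hy : y ∈ M.commutant) : Commute x y :=
  mem_commutant_iff.1 hy x hx

theorem exists_mul_self_of_nonneg {x : M} (hx : 0 ≤ x) :
    ∃ s : M, 0 ≤ s ∧ s * s = x := by
  have hx' : (0 : H →L[ℂ] H) ≤ x := hx
  refine ⟨⟨CFC.sqrt (x : H →L[ℂ] H), mem_of_commute fun y hy => ?_⟩,
    show (0 : H →L[ℂ] H) ≤ CFC.sqrt (x : H →L[ℂ] H) from CFC.sqrt_nonneg _, ?_⟩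
  · rw [CFC.sqrt_eq_cfc (a := (x : H →L[ℂ] H))]
    exact (commute_of_mem x.2 hy).cfc_nnreal _
  · exact Subtype.ext (CFC.sqrt_mul_sqrt_self _ hx')

variable (M)

instance starOrderedRing : StarOrderedRing M := by
  refine .of_nonneg_iff' (fun h z => ?_) fun x => ⟨fun h => ?_, ?_⟩
  · exact add_le_add_right (α := H →L[ℂ] H) h _
  · obtain ⟨s, hs, rfl⟩ := exists_mul_self_of_nonneg h
    refine ⟨s, ?_⟩
    rw [show star s = s from
      Subtype.ext (IsSelfAdjoint.of_nonneg (show (0 : H →L[ℂ] H) ≤ s from hs))]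
  · rintro ⟨s, rfl⟩
    exact star_mul_self_nonneg (s : H →L[ℂ] H)

end Structure
end VonNeumannAlgebra

/-! ### Weak limits and suprema of increasing nets -/

namespace VonNeumannAlgebra
section WeakLimits
open Filter Topology
variable {H : Type*} [NormedAddCommGroup H] [InnerProductSpace ℂ H]

/-- Convergence of a family of operators along a filter, in the weak operator topology. -/
def WeakTendsto {ι : Type*} (f : ι → H →L[ℂ] H) (F : Filter ι) (b : H →L[ℂ] H) : Prop :=
  ∀ ξ η : H, Tendsto (fun i => inner ℂ ξ (f i η)) F (𝓝 (inner ℂ ξ (b η)))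

theorem le_of_reApplyInnerSelf_le [CompleteSpace H] {a b : H →L[ℂ] H}
    (ha : IsSelfAdjoint a) (hb : IsSelfAdjoint b)
    (h : ∀ ξ, a.reApplyInnerSelf ξ ≤ b.reApplyInnerSelf ξ) : a ≤ b := by
  rw [ContinuousLinearMap.le_def, ContinuousLinearMap.isPositive_def']
  refine ⟨hb.sub ha, fun ξ => ?_⟩
  have := h ξ
  simp only [ContinuousLinearMap.reApplyInnerSelf_apply, sub_apply,
    inner_sub_left, map_sub] at this ⊢
  linarith

theorem reApplyInnerSelf_mono {a b : H →L[ℂ] H} (h : a ≤ b) (ξ : H) :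
    a.reApplyInnerSelf ξ ≤ b.reApplyInnerSelf ξ := by
  rw [ContinuousLinearMap.le_def] at h
  have := h.2 ξ
  simp only [ContinuousLinearMap.reApplyInnerSelf_apply, sub_apply,
    inner_sub_left, map_sub] at this ⊢
  linarith

namespace WeakTendsto
variable {ι : Type*} {f : ι → H →L[ℂ] H} {F : Filter ι} {b : H →L[ℂ] H}

theorem reApplyInnerSelf (h : WeakTendsto f F b) (ξ : H) :
    Tendsto (fun i => (f i).reApplyInnerSelf ξ) F (𝓝 (b.reApplyInnerSelf ξ)) := by
  simp only [ContinuousLinearMap.reApplyInnerSelf_apply, inner_re_symm (𝕜 := ℂ) _ ξ]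
  exact (Complex.continuous_re.tendsto _).comp (h ξ ξ)

theorem mul_right (h : WeakTendsto f F b) (a : H →L[ℂ] H) :
    WeakTendsto (fun i => f i * a) F (b * a) := fun ξ η => h ξ (a η)

variable [CompleteSpace H]

theorem commute [F.NeBot] (h : WeakTendsto f F b) {c : H →L[ℂ] H} (hc : ∀ i, Commute (f i) c) :
    Commute b c := by
  refine ContinuousLinearMap.ext fun η => ext_inner_left ℂ fun ξ => ?_
  have h₁ := h ξ (c η)
  have h₂ := h (ContinuousLinearMap.adjoint c ξ) η
  simp only [ContinuousLinearMap.adjoint_inner_left] at h₂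
  refine tendsto_nhds_unique h₁ (h₂.congr fun i => ?_)
  exact congrArg (inner ℂ ξ) (DFunLike.congr_fun (hc i).eq η).symm

theorem mem [F.NeBot] (h : WeakTendsto f F b) {M : VonNeumannAlgebra H} (hf : ∀ i, f i ∈ M) :
    b ∈ M :=
  mem_of_commute fun _ hy => h.commute fun i => commute_of_mem (hf i) hy

theorem isSelfAdjoint [F.NeBot] (h : WeakTendsto f F b) (hf : ∀ i, IsSelfAdjoint (f i)) :
    IsSelfAdjoint b := by
  rw [ContinuousLinearMap.isSelfAdjoint_iff_isSymmetric]
  intro ξ η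
  change inner ℂ (b ξ) η = inner ℂ ξ (b η)
  rw [← inner_conj_symm]
  refine tendsto_nhds_unique (((Complex.continuous_conj.tendsto _).comp (h η ξ)).congr
    fun i => ?_) (h ξ η)
  rw [Function.comp, inner_conj_symm]
  exact ContinuousLinearMap.isSelfAdjoint_iff_isSymmetric.1 (hf i) ξ η

theorem le_of_eventually_le [F.NeBot] (h : WeakTendsto f F b) (hf : ∀ i, IsSelfAdjoint (f i))
    {a : H →L[ℂ] H} (ha : IsSelfAdjoint a) (hle : ∀ᶠ i in F, f i ≤ a) : b ≤ a :=
  le_of_reApplyInnerSelf_le (h.isSelfAdjoint hf) ha fun ξ =>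
    le_of_tendsto (h.reApplyInnerSelf ξ) (hle.mono fun _ hi => reApplyInnerSelf_mono hi ξ)

theorem ge_of_eventually_ge [F.NeBot] (h : WeakTendsto f F b) (hf : ∀ i, IsSelfAdjoint (f i))
    {a : H →L[ℂ] H} (ha : IsSelfAdjoint a) (hle : ∀ᶠ i in F, a ≤ f i) : a ≤ b :=
  le_of_reApplyInnerSelf_le ha (h.isSelfAdjoint hf) fun ξ =>
    ge_of_tendsto (h.reApplyInnerSelf ξ) (hle.mono fun _ hi => reApplyInnerSelf_mono hi ξ)

end WeakTendsto

variable [CompleteSpace H]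

/-- Bounded sets of operators are relatively compact in the weak operator topology. -/
theorem exists_weakTendsto {ι : Type*} (U : Ultrafilter ι) (f : ι → H →L[ℂ] H) {C : ℝ}
    (hf : ∀ᶠ i in (U : Filter ι), ‖f i‖ ≤ C) : ∃ b, WeakTendsto f U b := by
  have bound (ξ η : H) : ∀ᶠ i in (U : Filter ι), ‖inner ℂ (f i ξ) η‖ ≤ C * ‖ξ‖ * ‖η‖ :=
    hf.mono fun i hi => (norm_inner_le_norm _ _).trans <| by
      gcongr; exact (f i).le_of_opNorm_le hi ξ
  have lim (ξ η : H) : ∃ z, Tendsto (fun i => inner ℂ (f i ξ) η) U (𝓝 z) := by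
    obtain ⟨z, -, hz⟩ := (isCompact_closedBall (0 : ℂ) (C * ‖ξ‖ * ‖η‖)).ultrafilter_le_nhds
      (U.map fun i => inner ℂ (f i ξ) η) (by
        rw [Filter.le_principal_iff]
        exact (bound ξ η).mono fun i hi => by simpa using hi)
    exact ⟨z, hz⟩
  choose z hz using lim
  -- The limits of the matrix coefficients form a bounded sesquilinear form, which the Riesz theorem
  -- represents by an operator.
  let B : H →L⋆[ℂ] H →L[ℂ] ℂ := LinearMap.mkContinuous₂
    (LinearMap.mk₂'ₛₗ (starRingEnd ℂ) (RingHom.id ℂ) z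
      (fun ξ ξ' η => tendsto_nhds_unique (hz _ _) <| by
        simpa [inner_add_left] using (hz ξ η).add (hz ξ' η))
      (fun c ξ η => tendsto_nhds_unique (hz _ _) <| by
        simpa [inner_smul_left, mul_comm] using (hz ξ η).const_mul (starRingEnd ℂ c))
      (fun ξ η η' => tendsto_nhds_unique (hz _ _) <| by
        simpa [inner_add_right] using (hz ξ η).add (hz ξ η'))
      (fun c ξ η => tendsto_nhds_unique (hz _ _) <| by
        simpa [inner_smul_right] using (hz ξ η).const_mul c)) C
    (fun ξ η => le_of_tendsto (hz ξ η).norm (bound ξ η))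
  refine ⟨InnerProductSpace.continuousLinearMapOfBilin B, fun ξ η => ?_⟩
  have h : inner ℂ (InnerProductSpace.continuousLinearMapOfBilin B η) ξ = z η ξ :=
    InnerProductSpace.continuousLinearMapOfBilin_apply B η ξ
  rw [← inner_conj_symm, h]
  refine ((Complex.continuous_conj.tendsto _).comp (hz η ξ)).congr fun i => ?_
  simp [Function.comp]

theorem norm_le_of_le_of_le {a x y : H →L[ℂ] H} (hay : a ≤ y) (hyx : y ≤ x) :
    ‖y‖ ≤ ‖x - a‖ + ‖a‖ := by
  calc ‖y‖ = ‖(y - a) + a‖ := by rw [sub_add_cancel]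
    _ ≤ ‖y - a‖ + ‖a‖ := norm_add_le _ _
    _ ≤ ‖x - a‖ + ‖a‖ := by
      gcongr
      exact CStarAlgebra.norm_le_norm_of_nonneg_of_le (sub_nonneg.2 hay) (by gcongr)

/-- Beyond any `a ∈ D` the net is norm bounded, hence has a weak limit along an ultrafilter finer
than the order; order bounds and membership in `M` pass to weak limits. The clause on quadratic
forms later makes vector functionals normal. -/
theorem exists_isLUB_and_isLUB_reApplyInnerSelf {D : Set (H →L[ℂ] H)} (hne : D.Nonempty)
    (hdir : DirectedOn (· ≤ ·) D) (hsa : ∀ y ∈ D, IsSelfAdjoint y) (hbdd : BddAbove D) :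
    ∃ b, IsLUB D b ∧ (∀ M : VonNeumannAlgebra H, D ⊆ M → b ∈ M) ∧
      ∀ ξ, IsLUB ((fun y => y.reApplyInnerSelf ξ) '' D) (b.reApplyInnerSelf ξ) := by
  obtain ⟨x, hx⟩ := hbdd
  obtain ⟨a, ha⟩ := hne
  have : Nonempty D := ⟨⟨a, ha⟩⟩
  have : IsDirected D (· ≤ ·) := directedOn_iff_isDirectedOrder.1 hdir
  let U : Ultrafilter D := Ultrafilter.of atTop
  have hU : (U : Filter D) ≤ atTop := Ultrafilter.of_le _
  have hge (y : D) : ∀ᶠ i in (U : Filter D), y ≤ i := hU (eventually_ge_atTop y)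
  obtain ⟨b, hb⟩ := exists_weakTendsto U (fun i : D => (i : H →L[ℂ] H)) (C := ‖x - a‖ + ‖a‖)
    ((hge ⟨a, ha⟩).mono fun i hi => norm_le_of_le_of_le hi (hx i.2))
  have hsa' : ∀ i : D, IsSelfAdjoint (i : H →L[ℂ] H) := fun i => hsa i i.2
  have hub : ∀ y ∈ D, y ≤ b := fun y hy =>
    hb.ge_of_eventually_ge hsa' (hsa y hy) (hge ⟨y, hy⟩)
  refine ⟨b, ⟨hub, fun u hu => ?_⟩, fun M hM => hb.mem fun i => hM i.2, fun ξ => ⟨?_, ?_⟩⟩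
  · have hu' : IsSelfAdjoint u := by
      have := (IsSelfAdjoint.of_nonneg (sub_nonneg.2 (hu ha))).add (hsa a ha)
      rwa [sub_add_cancel] at this
    exact hb.le_of_eventually_le hsa' hu' (.of_forall fun i => hu i.2)
  · rintro _ ⟨y, hy, rfl⟩
    exact reApplyInnerSelf_mono (hub y hy) ξ
  · intro c hc
    exact le_of_tendsto (hb.reApplyInnerSelf ξ) (.of_forall fun i => hc ⟨i, i.2, rfl⟩)

/-- An increasing net with an upper bound in a von Neumann algebra has a least upper bound. -/
theorem exists_isLUB {M : VonNeumannAlgebra H} {D : Set M} (hne : D.Nonempty)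
    (hdir : DirectedOn (· ≤ ·) D) (hsa : ∀ y ∈ D, IsSelfAdjoint y) (hbdd : BddAbove D) :
    ∃ b : M, IsLUB D b ∧ IsLUB ((↑) '' D : Set (H →L[ℂ] H)) b ∧
      ∀ ξ, IsLUB ((fun y : M => (y : H →L[ℂ] H).reApplyInnerSelf ξ) '' D)
        ((b : H →L[ℂ] H).reApplyInnerSelf ξ) := by
  obtain ⟨b, hb, hbM, hbξ⟩ := exists_isLUB_and_isLUB_reApplyInnerSelf
    (D := ((↑) '' D : Set (H →L[ℂ] H))) (hne.image _)
    (by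
      rintro _ ⟨y, hy, rfl⟩ _ ⟨z, hz, rfl⟩
      obtain ⟨w, hw, h₁, h₂⟩ := hdir y hy z hz
      exact ⟨w, ⟨w, hw, rfl⟩, h₁, h₂⟩)
    (by rintro _ ⟨y, hy, rfl⟩; exact congrArg Subtype.val (hsa y hy))
    (by
      obtain ⟨x, hx⟩ := hbdd
      exact ⟨x, by rintro _ ⟨y, hy, rfl⟩; exact hx hy⟩)
  refine ⟨⟨b, hbM M (by rintro _ ⟨y, _, rfl⟩; exact y.2)⟩, ⟨fun y hy => hb.1 ⟨y, hy, rfl⟩,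
    fun u hu => hb.2 (by rintro _ ⟨y, hy, rfl⟩; exact hu hy)⟩, hb, fun ξ => ?_⟩
  simpa [Set.image_image] using hbξ ξ

theorem isLUB_image_coe {M : VonNeumannAlgebra H} {D : Set M} {x : M} (hne : D.Nonempty)
    (hdir : DirectedOn (· ≤ ·) D) (hsa : ∀ y ∈ D, IsSelfAdjoint y) (hx : IsLUB D x) :
    IsLUB ((↑) '' D : Set (H →L[ℂ] H)) x ∧
      ∀ ξ, IsLUB ((fun y : M => (y : H →L[ℂ] H).reApplyInnerSelf ξ) '' D)
        ((x : H →L[ℂ] H).reApplyInnerSelf ξ) := by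
  obtain ⟨b, hb, h⟩ := exists_isLUB hne hdir hsa ⟨x, hx.1⟩
  rwa [hx.unique hb]

end WeakLimits
end VonNeumannAlgebra

/-! ### Weak continuity of normal positive functionals -/

namespace VonNeumannAlgebra
section NormalFunctionals
open Filter Topology
variable {H : Type*} [NormedAddCommGroup H] [InnerProductSpace ℂ H] [CompleteSpace H]
  {M : VonNeumannAlgebra H}

/-- A functional that is continuous for the weak operator topology on bounded sets. -/
def IsWeaklyContinuous (f : M →ₗ[ℂ] ℂ) : Prop :=
  ∀ (F : Filter M) (b : M) (C : ℝ), (∀ᶠ y in F, ‖y‖ ≤ C) →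
    WeakTendsto (fun y : M => (y : H →L[ℂ] H)) F b → Tendsto f F (𝓝 (f b))

namespace IsWeaklyContinuous

theorem tendsto {f : M →ₗ[ℂ] ℂ} (hf : IsWeaklyContinuous f) {ι : Type*} {F : Filter ι}
    {g : ι → M} {b : M} {C : ℝ} (hC : ∀ᶠ i in F, ‖g i‖ ≤ C)
    (hg : WeakTendsto (fun i => (g i : H →L[ℂ] H)) F b) : Tendsto (fun i => f (g i)) F (𝓝 (f b)) :=
  tendsto_map'_iff.1 (hf (F.map g) b C (by simpa using hC) fun ξ η => tendsto_map'_iff.2 (hg ξ η))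

theorem add {f g : M →ₗ[ℂ] ℂ} (hf : IsWeaklyContinuous f) (hg : IsWeaklyContinuous g) :
    IsWeaklyContinuous (f + g) :=
  fun F b C hC h => (hf F b C hC h).add (hg F b C hC h)

theorem sum {ι : Type*} (s : Finset ι) {f : ι → M →ₗ[ℂ] ℂ}
    (hf : ∀ i ∈ s, IsWeaklyContinuous (f i)) : IsWeaklyContinuous (∑ i ∈ s, f i) := by
  intro F b C hC h
  rw [LinearMap.sum_apply]
  exact (tendsto_finsetSum s fun i hi => hf i hi F b C hC h).congr fun y =>
    (LinearMap.sum_apply s f y).symm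

theorem comp_mulRight {f : M →ₗ[ℂ] ℂ} (hf : IsWeaklyContinuous f) (a : M) :
    IsWeaklyContinuous (f ∘ₗ LinearMap.mulRight ℂ a) := by
  intro F b C hC h
  refine hf.tendsto (C := C * ‖a‖) (hC.mono fun y hy => ?_) (h.mul_right a)
  exact (norm_mul_le y a).trans (by gcongr)

theorem of_approx {f : M →ₗ[ℂ] ℂ}
    (h : ∀ ε > 0, ∃ g : M →ₗ[ℂ] ℂ, IsWeaklyContinuous g ∧ ∀ y, ‖f y - g y‖ ≤ ε * ‖y‖) :
    IsWeaklyContinuous f := by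
  intro F b C hC hF
  rw [Metric.tendsto_nhds]
  intro ε hε
  set K := |C| + ‖b‖ + 1
  have hK : 0 < K := by positivity
  obtain ⟨g, hg, hfg⟩ := h (ε / (3 * K)) (by positivity)
  have key (y : M) (hy : ‖y‖ ≤ K) : ‖f y - g y‖ ≤ ε / 3 := by
    refine (hfg y).trans ?_
    calc ε / (3 * K) * ‖y‖ ≤ ε / (3 * K) * K := by gcongr
      _ = ε / 3 := by field_simp
  filter_upwards [hC, Metric.tendsto_nhds.1 (hg F b C hC hF) (ε / 3) (by positivity)] with y hy hyg
  have h₁ := key y (by have := le_abs_self C; have := norm_nonneg b; simp only [K]; linarith)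
  have h₂ := key b (by have := abs_nonneg C; simp only [K]; linarith)
  rw [dist_eq_norm] at hyg ⊢
  calc ‖f y - f b‖ = ‖(f y - g y) + (g y - g b) - (f b - g b)‖ := by congr 1; ring
    _ ≤ ‖f y - g y‖ + ‖g y - g b‖ + ‖f b - g b‖ :=
      (norm_sub_le _ _).trans (by gcongr; exact norm_add_le _ _)
    _ < ε := by linarith

/-- The bound lets `f` factor through `y ↦ y ζ` as a bounded functional; Hahn–Banach and Riesz turn
`f` into a matrix coefficient. -/
theorem of_norm_le_norm_apply {f : M →ₗ[ℂ] ℂ} (ζ : H) (C : ℝ)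
    (h : ∀ y : M, ‖f y‖ ≤ C * ‖(y : H →L[ℂ] H) ζ‖) : IsWeaklyContinuous f := by
  let g : M →ₗ[ℂ] H :=
    { toFun := fun y => (y : H →L[ℂ] H) ζ
      map_add' := fun _ _ => rfl
      map_smul' := fun _ _ => rfl }
  have hf : f ∈ LinearMap.range g.dualMap := by
    rw [LinearMap.range_dualMap_eq_dualAnnihilator_ker, Submodule.mem_dualAnnihilator]
    intro y hy
    have hy' : (y : H →L[ℂ] H) ζ = 0 := hy
    simpa [hy'] using h y
  obtain ⟨l, rfl⟩ := hf
  obtain ⟨k, hk, -⟩ := exists_extension_norm_eq (LinearMap.range g)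
    (LinearMap.mkContinuous (l ∘ₗ (LinearMap.range g).subtype) C (by
      rintro ⟨_, y, rfl⟩
      exact h y))
  have hk' (y : M) : l (g y) = inner ℂ ((InnerProductSpace.toDual ℂ H).symm k)
      ((y : H →L[ℂ] H) ζ) := by
    rw [InnerProductSpace.toDual_symm_apply]
    exact (hk ⟨g y, y, rfl⟩).symm
  intro F b D hD hF
  refine (congrArg 𝓝 (hk' b)).symm ▸ (hF _ ζ).congr fun y => (hk' y).symm

end IsWeaklyContinuous

variable {ψ : M →ₗ[ℂ] ℂ}

theorem norm_apply_star_mul_sq_le (hpos : ∀ x : M, 0 ≤ x → 0 ≤ ψ x) (x y : M) :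
    ‖ψ (star x * y)‖ ^ 2 ≤ (ψ (star x * x)).re * (ψ (star y * y)).re := by
  let := M.cstarAlgebra
  let f : M →ₚ[ℂ] ℂ := .mk₀ ψ hpos
  have h := norm_inner_le_norm (𝕜 := ℂ) (f.toPreGNS x) (f.toPreGNS y)
  have h₁ (a : M) : ‖f.toPreGNS a‖ ^ 2 = (ψ (star a * a)).re :=
    (by simp [← Complex.ofReal_pow] : ‖f.toPreGNS a‖ ^ 2 = ((‖f.toPreGNS a‖ : ℂ) ^ 2).re).trans
      (congrArg Complex.re (f.preGNS_norm_sq (f.toPreGNS a)))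
  rw [← h₁, ← h₁, ← mul_pow]
  gcongr
  exact h

theorem re_apply_mono (hpos : ∀ x : M, 0 ≤ x → 0 ≤ ψ x) {x y : M} (h : x ≤ y) :
    (ψ x).re ≤ (ψ y).re := by
  have := (Complex.le_def.1 (hpos _ (sub_nonneg.2 h))).1
  simp only [map_sub, Complex.sub_re, Complex.zero_re] at this
  linarith

theorem isChain_isLUB {c : Set M} (hc : IsChain (· ≤ ·) c) {a u : M} (ha : a ∈ c)
    (h0 : ∀ y ∈ c, 0 ≤ y) (hu : ∀ y ∈ c, y ≤ u) :
    DirectedOn (· ≤ ·) c ∧ (∀ y ∈ c, IsSelfAdjoint y) ∧ ∃ b : M, IsLUB c b ∧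
      ∀ ξ, IsLUB ((fun y : M => (y : H →L[ℂ] H).reApplyInnerSelf ξ) '' c)
        ((b : H →L[ℂ] H).reApplyInnerSelf ξ) := by
  have hsa : ∀ y ∈ c, IsSelfAdjoint y := fun y hy => IsSelfAdjoint.of_nonneg (h0 y hy)
  obtain ⟨b, hb, -, hb'⟩ := exists_isLUB ⟨a, ha⟩ hc.directedOn hsa ⟨u, hu⟩
  exact ⟨hc.directedOn, hsa, b, hb, hb'⟩

/-- Exhaustion: scale `ζ` until its vector functional exceeds `ψ` at `q`, and remove from `q` a
maximal `k` on which it does not. On the nonzero rest, any `l` violating the domination could be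
added to `k`. -/
theorem exists_le_reApplyInnerSelf (hnorm : IsNormalMap fun x => (ψ x).re) {q : M}
    (hq : 0 ≤ q) (hq0 : q ≠ 0) :
    ∃ r : M, 0 ≤ r ∧ r ≤ q ∧ r ≠ 0 ∧ ∃ ζ : H, ∀ k : M, 0 ≤ k → k ≤ r →
      (ψ k).re ≤ (k : H →L[ℂ] H).reApplyInnerSelf ζ := by
  obtain ⟨ζ, hζ⟩ : ∃ ζ, (ψ q).re < (q : H →L[ℂ] H).reApplyInnerSelf ζ := by
    obtain ⟨ζ, hζ⟩ : ∃ ζ, 0 < (q : H →L[ℂ] H).reApplyInnerSelf ζ := by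
      by_contra! h
      refine hq0 (le_antisymm ?_ hq)
      exact le_of_reApplyInnerSelf_le (IsSelfAdjoint.of_nonneg (R := H →L[ℂ] H) hq) (.zero _)
        fun ξ => (h ξ).trans (by simp [ContinuousLinearMap.reApplyInnerSelf_apply])
    obtain ⟨n, hn⟩ := exists_nat_gt ((ψ q).re / (q : H →L[ℂ] H).reApplyInnerSelf ζ)
    rw [div_lt_iff₀ hζ] at hn
    refine ⟨((n + 1 : ℝ) : ℂ) • ζ, ?_⟩
    rw [ContinuousLinearMap.reApplyInnerSelf_smul, Complex.norm_real,
      Real.norm_of_nonneg (by positivity)]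
    refine hn.trans_le ?_
    gcongr
    nlinarith [(n.cast_nonneg : (0 : ℝ) ≤ n)]
  obtain ⟨k, -, hk⟩ := zorn_le_nonempty₀
    {k : M | 0 ≤ k ∧ k ≤ q ∧ (k : H →L[ℂ] H).reApplyInnerSelf ζ ≤ (ψ k).re}
    (fun c hc hchain a ha => by
      obtain ⟨hdir, hsa, b, hb, hbξ⟩ := isChain_isLUB hchain ha (fun y hy => (hc hy).1)
        fun y hy => (hc hy).2.1
      refine ⟨b, ⟨(hc ha).1.trans (hb.1 ha), hb.2 fun y hy => (hc hy).2.1, (hbξ ζ).2 ?_⟩, hb.1⟩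
      rintro _ ⟨y, hy, rfl⟩
      exact (hc hy).2.2.trans ((hnorm c b ⟨a, ha⟩ hdir hsa hb).1 ⟨y, hy, rfl⟩))
    0 ⟨le_rfl, hq, by simp [ContinuousLinearMap.reApplyInnerSelf_apply]⟩
  obtain ⟨⟨hk0, hkq, hkψ⟩, hmax⟩ := hk
  refine ⟨q - k, sub_nonneg.2 hkq, sub_le_self _ hk0, ?_, ζ, fun l hl hlr => ?_⟩
  · rintro h
    rw [sub_eq_zero] at h
    subst h
    exact hζ.not_ge hkψ
  · by_contra! hlt
    have hadd : ((k + l : M) : H →L[ℂ] H).reApplyInnerSelf ζ =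
        (k : H →L[ℂ] H).reApplyInnerSelf ζ + (l : H →L[ℂ] H).reApplyInnerSelf ζ := by
      simp [ContinuousLinearMap.reApplyInnerSelf_apply, inner_add_left]
    have := hmax (y := k + l) ⟨add_nonneg hk0 hl, by rwa [le_sub_iff_add_le, add_comm] at hlr, by
      rw [hadd, map_add, Complex.add_re]; linarith⟩ (le_add_of_nonneg_right hl)
    obtain rfl : l = 0 := le_antisymm (by simpa using this) hl
    simp [ContinuousLinearMap.reApplyInnerSelf_apply] at hlt

theorem mul_self_le_of_le_one {d : M} (h0 : 0 ≤ d) (h1 : d ≤ 1) : d * d ≤ d := by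
  obtain ⟨s, hs, rfl⟩ := exists_mul_self_of_nonneg h0
  have := IsSelfAdjoint.conjugate_le_conjugate h1 (IsSelfAdjoint.of_nonneg hs)
  simpa [mul_assoc] using this

theorem norm_le_one_of_nonneg {d : M} (h0 : 0 ≤ d) (h1 : d ≤ 1) : ‖d‖ ≤ 1 :=
  (CStarAlgebra.norm_le_one_iff_of_nonneg (d : H →L[ℂ] H) h0).2 h1

theorem mul_star_le_norm_sq (y : M) : y * star y ≤ ((‖y‖ ^ 2 : ℝ) : ℂ) • (1 : M) := by
  have h := CStarAlgebra.star_mul_le_algebraMap_norm_sq (a := star (y : H →L[ℂ] H))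
  rw [star_star, norm_star] at h
  refine h.trans_eq ?_
  rw [Algebra.algebraMap_eq_smul_one]
  exact (Complex.coe_smul (‖y‖ ^ 2) (1 : H →L[ℂ] H)).symm

theorem norm_apply_mul_le (hpos : ∀ x : M, 0 ≤ x → 0 ≤ ψ x) (y d : M) :
    ‖ψ (y * d)‖ ≤ ‖y‖ * √((ψ 1).re * (ψ (star d * d)).re) := by
  have h := norm_apply_star_mul_sq_le hpos (star y) d
  rw [star_star] at h
  have h₁ : (ψ (y * star y)).re ≤ ‖y‖ ^ 2 * (ψ 1).re := by
    refine (re_apply_mono hpos (mul_star_le_norm_sq y)).trans_eq ?_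
    rw [map_smul, smul_eq_mul, Complex.re_ofReal_mul]
  have h₂ : 0 ≤ (ψ (star d * d)).re := (Complex.le_def.1 (hpos _ (star_mul_self_nonneg d))).1
  rw [← Real.sqrt_sq (norm_nonneg y), ← Real.sqrt_mul (sq_nonneg _), ← mul_assoc]
  refine Real.le_sqrt_of_sq_le (h.trans ?_)
  gcongr

/-- A normal positive functional is continuous for the weak operator topology on bounded sets. -/
theorem isWeaklyContinuous_of_isNormalMap (hpos : ∀ x : M, 0 ≤ x → 0 ≤ ψ x)
    (hnorm : IsNormalMap fun x => (ψ x).re) : IsWeaklyContinuous ψ := by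
  -- Zorn on the `h` in `[0, 1]` for which `y ↦ ψ (y * h)` is weakly continuous; the goal is `h =
  -- 1`. For a chain with supremum `b`, Cauchy–Schwarz and `(b - y) ^ 2 ≤ b - y` reduce the
  -- approximation to `ψ (b - y)` being small, which is normality.
  obtain ⟨h, -, ⟨⟨hh0, hh1, hhW⟩, hmax⟩⟩ := zorn_le_nonempty₀
    {h : M | 0 ≤ h ∧ h ≤ 1 ∧ IsWeaklyContinuous (ψ ∘ₗ LinearMap.mulRight ℂ h)}
    (fun c hc hchain a ha => by
      obtain ⟨hdir, hsa, b, hb, -⟩ := isChain_isLUB hchain ha (fun y hy => (hc hy).1)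
        fun y hy => (hc hy).2.1
      have hb1 : b ≤ 1 := hb.2 fun y hy => (hc hy).2.1
      refine ⟨b, ⟨(hc ha).1.trans (hb.1 ha), hb1, .of_approx fun ε hε => ?_⟩, hb.1⟩
      have hψ1 : 0 ≤ (ψ 1).re := (Complex.le_def.1 (hpos _ zero_le_one)).1
      obtain ⟨_, ⟨y, hy, rfl⟩, hlt⟩ := (lt_isLUB_iff (hnorm c b ⟨a, ha⟩ hdir hsa hb)).1
        (sub_lt_self (ψ b).re (show 0 < ε ^ 2 / ((ψ 1).re + 1) by positivity))
      refine ⟨_, (hc hy).2.2, fun z => ?_⟩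
      have hd0 : 0 ≤ b - y := sub_nonneg.2 (hb.1 hy)
      have hd1 : b - y ≤ 1 := (sub_le_self _ (hc hy).1).trans hb1
      simp only [LinearMap.comp_apply, LinearMap.mulRight_apply, ← map_sub, ← mul_sub]
      refine (norm_apply_mul_le hpos z (b - y)).trans ?_
      rw [mul_comm]
      gcongr
      rw [Real.sqrt_le_left hε.le, (IsSelfAdjoint.of_nonneg hd0).star_eq]
      have h₁ := re_apply_mono hpos (mul_self_le_of_le_one hd0 hd1)
      have h₂ : (ψ (b - y)).re ≤ ε ^ 2 / ((ψ 1).re + 1) := by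
        rw [map_sub, Complex.sub_re]; simp only at hlt; linarith
      calc (ψ 1).re * (ψ ((b - y) * (b - y))).re
          ≤ ((ψ 1).re + 1) * (ε ^ 2 / ((ψ 1).re + 1)) := by
            gcongr
            · exact (Complex.le_def.1 (hpos _ ((IsSelfAdjoint.of_nonneg hd0).mul_self_nonneg))).1
            · linarith
            · exact h₁.trans h₂
        _ = ε ^ 2 := by field_simp)
    0 ⟨le_rfl, zero_le_one, by
      rw [LinearMap.mulRight_zero_eq_zero, LinearMap.comp_zero]
      exact fun _ _ _ _ _ => tendsto_const_nhds⟩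
  -- Otherwise some nonzero `r = s * s ≤ 1 - h` has `ψ` dominated below it by the vector functional
  -- of `ζ`. Then `|ψ (y * s)|² ≤ ψ 1 * ‖y (s ζ)‖²`, so `h + s * s` contradicts maximality.
  obtain rfl : h = 1 := by
    by_contra hne
    obtain ⟨r, hr0, hrq, hr, ζ, hζ⟩ := exists_le_reApplyInnerSelf hnorm (sub_nonneg.2 hh1)
      (sub_ne_zero.2 (Ne.symm hne))
    obtain ⟨s, hs, rfl⟩ := exists_mul_self_of_nonneg hr0
    have hs' : star s = s := (IsSelfAdjoint.of_nonneg hs).star_eq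
    have hW : IsWeaklyContinuous (ψ ∘ₗ LinearMap.mulRight ℂ s) := by
      refine .of_norm_le_norm_apply ((s : H →L[ℂ] H) ζ) (√(ψ 1).re) fun y => ?_
      have hψ1 : 0 ≤ (ψ 1).re := (Complex.le_def.1 (hpos _ zero_le_one)).1
      set k : M := star (y * s) * (y * s) with hk
      have hk0 : 0 ≤ k := star_mul_self_nonneg _
      have hkω : (k : H →L[ℂ] H).reApplyInnerSelf ζ = ‖(y : H →L[ℂ] H) ((s : H →L[ℂ] H) ζ)‖ ^ 2 :=
        ((y * s : M) : H →L[ℂ] H).apply_norm_sq_eq_inner_adjoint_left ζ |>.symm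
      -- The factor brings `k` below `s * s`, where the domination applies; it cancels afterwards by
      -- homogeneity.
      set c : ℝ := (‖y‖ ^ 2 + 1)⁻¹
      have hc : 0 < c := by positivity
      have hkr : (c : ℂ) • k ≤ s * s := by
        have h₁ : star y * y ≤ ((‖y‖ ^ 2 : ℝ) : ℂ) • (1 : M) := by
          simpa using mul_star_le_norm_sq (star y)
        have h₂ := IsSelfAdjoint.conjugate_le_conjugate h₁ (IsSelfAdjoint.of_nonneg hs)
        have h₃ : k ≤ ((‖y‖ ^ 2 : ℝ) : ℂ) • (s * s) := by
          simpa [hk, star_mul, hs', mul_assoc] using h₂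
        refine (smul_le_smul_of_nonneg_left h₃ (show (0 : ℂ) ≤ c by exact_mod_cast hc.le)).trans ?_
        rw [smul_smul, ← Complex.ofReal_mul]
        refine (smul_le_smul_of_nonneg_right (show (((c * ‖y‖ ^ 2 : ℝ) : ℂ)) ≤ 1 from ?_)
          hr0).trans_eq (one_smul _ _)
        exact_mod_cast (inv_mul_le_one₀ (by positivity)).2 (by linarith)
      have hψk := hζ ((c : ℂ) • k) (smul_nonneg (show (0 : ℂ) ≤ c by exact_mod_cast hc.le) hk0) hkr
      have hcω : (((c : ℂ) • k : M) : H →L[ℂ] H).reApplyInnerSelf ζ =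
          c * (k : H →L[ℂ] H).reApplyInnerSelf ζ := by
        simp [ContinuousLinearMap.reApplyInnerSelf_apply]
      rw [hcω, map_smul, smul_eq_mul, Complex.re_ofReal_mul, hkω, mul_le_mul_iff_right₀ hc] at hψk
      have hCS := norm_apply_star_mul_sq_le hpos 1 (y * s)
      rw [star_one, one_mul, one_mul] at hCS
      rw [← Real.sqrt_sq (norm_nonneg ((y : H →L[ℂ] H) _)), ← Real.sqrt_mul hψ1]
      exact Real.le_sqrt_of_sq_le (hCS.trans (by gcongr))
    have hsum : IsWeaklyContinuous (ψ ∘ₗ LinearMap.mulRight ℂ (h + s * s)) := by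
      have := hhW.add (hW.comp_mulRight s)
      convert this using 1
      ext y
      simp [mul_add, mul_assoc]
    have := hmax (y := h + s * s) ⟨add_nonneg hh0 hr0, by
      rwa [le_sub_iff_add_le, add_comm] at hrq, hsum⟩ (le_add_of_nonneg_right hr0)
    exact hr (le_antisymm (by simpa using this) hr0)
  rwa [LinearMap.mulRight_one, LinearMap.comp_id] at hhW

end NormalFunctionals
end VonNeumannAlgebra

/-! ### Projection to a subalgebra for a scalar trace -/

namespace VonNeumannAlgebra
section Projection
open Filter Topology
variable {H : Type*} [NormedAddCommGroup H] [InnerProductSpace ℂ H] [CompleteSpace H]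
  {M N : VonNeumannAlgebra H}

section Incl
variable (h : N ≤ M)

theorem incl_add (a b : N) : incl h (a + b) = incl h a + incl h b := rfl
theorem incl_sub (a b : N) : incl h (a - b) = incl h a - incl h b := rfl
theorem incl_mul (a b : N) : incl h (a * b) = incl h a * incl h b := rfl
theorem incl_smul (c : ℂ) (a : N) : incl h (c • a) = c • incl h a := rfl
theorem incl_star (a : N) : incl h (star a) = star (incl h a) := rfl
theorem incl_zero : incl h (0 : N) = 0 := rfl
theorem incl_one : incl h (1 : N) = 1 := rfl
theorem incl_nonneg {a : N} : 0 ≤ incl h a ↔ 0 ≤ a := Iff.rfl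
theorem incl_injective : Function.Injective (incl h) := fun _ _ e =>
  Subtype.ext (congrArg (Subtype.val : M → H →L[ℂ] H) e)

end Incl

theorem isSelfAdjoint_of_le {a y : M} (ha : IsSelfAdjoint a) (h : a ≤ y) : IsSelfAdjoint y := by
  simpa using (IsSelfAdjoint.of_nonneg (sub_nonneg.2 h)).add ha

/-- Here `g` truncates `b` to `[0, 1]`, and `u`, `v` are the excesses above `1` and below `0`: `g`
is `1` on the support of `u` and `0` on that of `v`. -/
theorem exists_clamp {b : N} (hb : IsSelfAdjoint b) :
    ∃ g u v : N, 0 ≤ g ∧ g ≤ 1 ∧ 0 ≤ u ∧ 0 ≤ v ∧ b = g + u - v ∧ g * u = u ∧ g * v = 0 := by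
  refine ⟨cfc (fun t : ℝ => max 0 (min 1 t)) b, cfc (fun t : ℝ => max 0 (t - 1)) b,
    cfc (fun t : ℝ => max 0 (-t)) b, cfc_nonneg fun t _ => le_max_left _ _,
    cfc_le_one _ _ fun t _ => max_le zero_le_one (min_le_left _ _),
    cfc_nonneg fun t _ => le_max_left _ _, cfc_nonneg fun t _ => le_max_left _ _, ?_, ?_, ?_⟩
  · rw [← cfc_add .., ← cfc_sub ..]
    conv_lhs => rw [← cfc_id' ℝ b]
    congr 1
    ext t
    grind
  · rw [← cfc_mul ..]
    congr 1
    ext t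
    grind
  · rw [← cfc_mul .., ← cfc_zero ℝ b]
    congr 1
    ext t
    simp only [Pi.zero_apply]
    grind

variable {τ : M →ₗ[ℂ] ℂ}

theorem apply_mul_nonneg (hpos : ∀ x : M, 0 ≤ x → 0 ≤ τ x) (htr : ∀ x y, τ (x * y) = τ (y * x))
    {p q : M} (hp : 0 ≤ p) (hq : 0 ≤ q) : 0 ≤ τ (p * q) := by
  obtain ⟨s, hs, rfl⟩ := exists_mul_self_of_nonneg hp
  rw [mul_assoc, htr]
  exact hpos _ (IsSelfAdjoint.conjugate_nonneg hq (IsSelfAdjoint.of_nonneg hs))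

theorem re_apply_sub_mul_sub (htr : ∀ x y, τ (x * y) = τ (y * x)) (p q : M) :
    (τ ((p - q) * (p - q))).re = (τ (p * p)).re - 2 * (τ (p * q)).re + (τ (q * q)).re := by
  rw [sub_mul, mul_sub, mul_sub, map_sub, map_sub, map_sub, htr q p]
  simp only [Complex.sub_re]
  ring

/-- The squared distance in the seminorm of a trace has a minimum on an operator interval. -/
theorem exists_minimizer (hpos : ∀ x : M, 0 ≤ x → 0 ≤ τ x) (htr : ∀ x y, τ (x * y) = τ (y * x))
    (hW : IsWeaklyContinuous τ) (hNM : N ≤ M) {x : M} (hx : IsSelfAdjoint x) {l u : N}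
    (hl : IsSelfAdjoint l) (hlu : l ≤ u) :
    ∃ b : N, l ≤ b ∧ b ≤ u ∧ ∀ c : N, l ≤ c → c ≤ u →
      (τ ((x - incl hNM b) * (x - incl hNM b))).re ≤
        (τ ((x - incl hNM c) * (x - incl hNM c))).re := by
  set Q : N → ℝ := fun b => (τ ((x - incl hNM b) * (x - incl hNM b))).re with hQ
  have hsa {c : N} (hc : l ≤ c) : IsSelfAdjoint c := isSelfAdjoint_of_le hl hc
  have hsq {y : M} (hy : IsSelfAdjoint y) : 0 ≤ (τ (y * y)).re :=
    (Complex.le_def.1 (hpos _ hy.mul_self_nonneg)).1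
  have hsub {c : N} (hc : l ≤ c) : IsSelfAdjoint (x - incl hNM c) :=
    hx.sub (congrArg (incl hNM) (hsa hc))
  have hne : (Q '' Set.Icc l u).Nonempty := ⟨_, l, ⟨le_rfl, hlu⟩, rfl⟩
  have hbdd : BddBelow (Q '' Set.Icc l u) := ⟨0, by
    rintro _ ⟨c, hc, rfl⟩; exact hsq (hsub hc.1)⟩
  obtain ⟨q, -, hq, hqS⟩ := exists_seq_tendsto_sInf hne hbdd
  choose c hc hcq using hqS
  set U : Ultrafilter ℕ := hyperfilter ℕ
  have hU : (U : Filter ℕ) ≤ atTop := Nat.hyperfilter_le_atTop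
  have hC (n : ℕ) : ‖(c n : H →L[ℂ] H)‖ ≤ ‖(u : H →L[ℂ] H) - l‖ + ‖(l : H →L[ℂ] H)‖ :=
    norm_le_of_le_of_le (hc n).1 (hc n).2
  have hcsa (n : ℕ) : IsSelfAdjoint (c n : H →L[ℂ] H) := congrArg Subtype.val (hsa (hc n).1)
  obtain ⟨b', hb'⟩ := exists_weakTendsto U (fun n => (c n : H →L[ℂ] H)) (.of_forall hC)
  obtain ⟨b, rfl⟩ : ∃ b : N, (b : H →L[ℂ] H) = b' := ⟨⟨b', hb'.mem fun n => (c n).2⟩, rfl⟩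
  have hlb : l ≤ b := hb'.ge_of_eventually_ge hcsa (congrArg Subtype.val hl)
    (.of_forall fun n => (hc n).1)
  have hbu : b ≤ u := hb'.le_of_eventually_le hcsa (congrArg Subtype.val (hsa hlu))
    (.of_forall fun n => (hc n).2)
  refine ⟨b, hlb, hbu, fun d hld hdu => ?_⟩
  have hlim : Tendsto (fun n => (τ ((x - incl hNM (c n)) * (x - incl hNM b))).re) U (𝓝 (Q b)) := by
    have h := (hW.comp_mulRight (x - incl hNM b)).tendsto (g := fun n => incl hNM (c n))
      (b := incl hNM b) (.of_forall hC) hb'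
    have h' := (Complex.continuous_re.tendsto _).comp (h.const_sub (τ (x * (x - incl hNM b))))
    simpa only [Function.comp_def, LinearMap.comp_apply, LinearMap.mulRight_apply, ← map_sub,
      ← sub_mul] using h'
  -- Squares are not weakly continuous; expanding `τ ((c n - b) ^ 2) ≥ 0` bounds `Q (c n)` below by
  -- an expression affine in `c n`, which has a limit.
  have hle (n : ℕ) : 2 * (τ ((x - incl hNM (c n)) * (x - incl hNM b))).re - Q b ≤ q n := by
    have h := hsq ((hsub (hc n).1).sub (hsub hlb))
    rw [re_apply_sub_mul_sub htr] at h
    rw [← hcq n]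
    simp only [hQ]
    linarith
  have := le_of_tendsto_of_tendsto' ((hlim.const_mul 2).sub_const (Q b)) (hq.mono_left hU) hle
  have h' := csInf_le hbdd ⟨d, ⟨hld, hdu⟩, rfl⟩
  simp only [hQ] at this h' ⊢
  linarith

theorem exists_forall_apply_sub_mul_eq_zero (hpos : ∀ x : M, 0 ≤ x → 0 ≤ τ x)
    (htr : ∀ x y, τ (x * y) = τ (y * x)) (hW : IsWeaklyContinuous τ) (hNM : N ≤ M) {x : M}
    (hx0 : 0 ≤ x) (hx1 : x ≤ 1) :
    ∃ b : N, 0 ≤ b ∧ b ≤ 1 ∧ ∀ c : N, τ ((x - incl hNM b) * incl hNM c) = 0 := by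
  have hsq {y : M} (hy : IsSelfAdjoint y) : 0 ≤ (τ (y * y)).re :=
    (Complex.le_def.1 (hpos _ hy.mul_self_nonneg)).1
  have hN1 : (0 : N) ≤ 1 := zero_le_one
  have hx : IsSelfAdjoint x := .of_nonneg hx0
  -- The interval exceeds `[0, 1]` by one on each side, so that `g + t • c` stays admissible for
  -- `g`, `c` in `[0, 1]` and `|t| ≤ 1`.
  obtain ⟨b, hb, -, hmin⟩ := exists_minimizer hpos htr hW hNM hx (l := -1) (u := 2)
    (IsSelfAdjoint.one _).neg ((neg_nonpos.2 hN1).trans zero_le_two)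
  obtain ⟨g, u, v, hg0, hg1, hu, hv, rfl, hgu, hgv⟩ :=
    exists_clamp (isSelfAdjoint_of_le (IsSelfAdjoint.one _).neg hb)
  -- Truncation does not increase the distance: with `w = u - v` the cross term is `(x - g) * w =
  -- -(1 - x) * u - x * v`, of trace at most `0`.
  have hgmin (c : N) (h₁ : -1 ≤ c) (h₂ : c ≤ 2) :
      (τ ((x - incl hNM g) * (x - incl hNM g))).re ≤
        (τ ((x - incl hNM c) * (x - incl hNM c))).re := by
    refine le_trans ?_ (hmin c h₁ h₂)
    set w := incl hNM u - incl hNM v with hw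
    have hwsa : IsSelfAdjoint w := .sub (.of_nonneg hu) (.of_nonneg hv)
    have hxg : x - incl hNM (g + u - v) = (x - incl hNM g) - w := by
      rw [incl_sub, incl_add, hw]; abel
    have h₁ : (x - incl hNM g) * w =
        -((1 - x) * incl hNM u) - x * incl hNM v := by
      have e₁ : incl hNM g * incl hNM u = incl hNM u := congrArg (incl hNM) hgu
      have e₂ : incl hNM g * incl hNM v = 0 := congrArg (incl hNM) hgv
      rw [hw, sub_mul, mul_sub, mul_sub, e₁, e₂, sub_mul, one_mul]
      abel
    have h₂ := (Complex.le_def.1 (apply_mul_nonneg hpos htr (sub_nonneg.2 hx1)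
      ((incl_nonneg hNM).2 hu))).1
    have h₃ := (Complex.le_def.1 (apply_mul_nonneg hpos htr hx0 ((incl_nonneg hNM).2 hv))).1
    have h₄ := hsq hwsa
    rw [hxg, re_apply_sub_mul_sub htr _ w, h₁]
    simp only [map_sub, map_neg, Complex.sub_re, Complex.neg_re, Complex.zero_re] at h₂ h₃ ⊢
    linarith
  have hunit (c : N) (hc0 : 0 ≤ c) (hc1 : c ≤ 1) :
      (τ ((x - incl hNM g) * incl hNM c)).re = 0 := by
    set A := (τ ((x - incl hNM g) * incl hNM c)).re with hA
    set B := (τ (incl hNM c * incl hNM c)).re with hB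
    have key (t : ℝ) (ht : |t| ≤ 1) : 2 * t * A ≤ t ^ 2 * B := by
      obtain ⟨ht₁, ht₂⟩ := abs_le.1 ht
      have h₁ : (t : ℂ) • c ≤ 1 :=
        (smul_le_smul_of_nonneg_right (show (t : ℂ) ≤ 1 by exact_mod_cast ht₂) hc0).trans
          (by rwa [one_smul])
      have h₂ : -1 ≤ (t : ℂ) • c := by
        refine (neg_le_neg hc1).trans ?_
        refine le_trans ?_
          (smul_le_smul_of_nonneg_right (show (-1 : ℂ) ≤ t by exact_mod_cast ht₁) hc0)
        rw [neg_one_smul]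
      have := hgmin (g + (t : ℂ) • c) (h₂.trans (le_add_of_nonneg_left hg0))
        ((add_le_add hg1 h₁).trans_eq one_add_one_eq_two)
      rw [incl_add, ← sub_sub, incl_smul, re_apply_sub_mul_sub htr _ (_ • _), mul_smul_comm,
        mul_smul_comm, smul_mul_assoc] at this
      simp only [map_smul, smul_eq_mul, Complex.re_ofReal_mul] at this
      rw [← hA, ← hB] at this
      nlinarith
    have hB0 : 0 ≤ B := hsq (.of_nonneg hc0)
    by_contra hne
    have hpos' : 0 < |A| := abs_pos.2 hne
    -- This `s` satisfies `s * B ≤ |A|`, so the linear term in `key` beats the quadratic one unless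
    -- `A = 0`.
    set s := |A| / (|A| + B) with hs
    have hs0 : 0 < s := by positivity
    have hs1 : s ≤ 1 := (div_le_one (by positivity)).2 (by linarith)
    have h₁ := key s (by rwa [abs_of_pos hs0])
    have h₂ := key (-s) (by rwa [abs_neg, abs_of_pos hs0])
    have h₃ : 2 * s * |A| ≤ s ^ 2 * B := by
      rcases abs_cases A with h | h <;> rw [h.1] <;> nlinarith
    have h₄ : s * B ≤ |A| := by
      rw [hs, div_mul_eq_mul_div, div_le_iff₀ (by positivity)]
      nlinarith
    nlinarith [mul_pos hs0 hpos']
  have hnonneg (c : N) (hc : 0 ≤ c) : τ ((x - incl hNM g) * incl hNM c) = 0 := by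
    apply Complex.ext
    · set r : ℝ := (‖(c : H →L[ℂ] H)‖ + 1)⁻¹
      have hr : 0 < r := by positivity
      have hr' : (0 : ℂ) ≤ r := by exact_mod_cast hr.le
      have := hunit ((r : ℂ) • c) (smul_nonneg hr' hc) (by
        refine (CStarAlgebra.norm_le_one_iff_of_nonneg ((r : ℂ) • (c : H →L[ℂ] H))
          (smul_nonneg hr' hc)).1 ?_
        rw [norm_smul, Complex.norm_real, Real.norm_of_nonneg hr.le]
        exact (inv_mul_le_one₀ (by positivity)).2 (by linarith))
      rw [incl_smul, mul_smul_comm, map_smul, smul_eq_mul, Complex.re_ofReal_mul] at this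
      simpa [hr.ne'] using this
    · have h₁ := (Complex.le_def.1 (apply_mul_nonneg hpos htr hx0 ((incl_nonneg hNM).2 hc))).2
      have h₂ := (Complex.le_def.1 (apply_mul_nonneg hpos htr ((incl_nonneg hNM).2 hg0)
        ((incl_nonneg hNM).2 hc))).2
      rw [sub_mul, map_sub, Complex.sub_im, ← h₁, ← h₂]
      simp
  refine ⟨g, hg0, hg1, fun c => ?_⟩
  have hc : c ∈ Submodule.span ℂ {a : N | 0 ≤ a} := by
    rw [CStarAlgebra.span_nonneg]; trivial
  induction hc using Submodule.span_induction with
  | mem c hc => exact hnonneg c hc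
  | zero => rw [incl_zero, mul_zero, map_zero]
  | add a b _ _ ha hb => rw [incl_add, mul_add, map_add, ha, hb, add_zero]
  | smul z a _ ha => rw [incl_smul, mul_smul_comm, map_smul, ha, smul_zero]

end Projection
end VonNeumannAlgebra

/-! ### The conditional expectation for a trace with values in `Z` -/

namespace VonNeumannAlgebra
section ConditionalExpectation
open Filter Topology
variable {H : Type*} [NormedAddCommGroup H] [InnerProductSpace ℂ H] [CompleteSpace H]
  {M N Z : VonNeumannAlgebra H}

theorem map_star_of_nonneg {T : M →ₗ[ℂ] N} (hT : ∀ x, 0 ≤ x → 0 ≤ T x) (x : M) :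
    T (star x) = star (T x) := by
  let := M.cstarAlgebra
  let := N.cstarAlgebra
  exact map_star (PositiveLinearMap.mk₀ T hT) x

theorem monotone_of_nonneg {T : M →ₗ[ℂ] N} (hT : ∀ x, 0 ≤ x → 0 ≤ T x) : Monotone T :=
  fun x y h => by simpa using hT _ (sub_nonneg.2 h)

theorem directedOn_image_and_isSelfAdjoint {T : M →ₗ[ℂ] N} (hT : ∀ x, 0 ≤ x → 0 ≤ T x)
    {D : Set M} (hdir : DirectedOn (· ≤ ·) D) (hsa : ∀ y ∈ D, IsSelfAdjoint y) :
    DirectedOn (· ≤ ·) (T '' D) ∧ ∀ y ∈ T '' D, IsSelfAdjoint y := by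
  constructor
  · rintro _ ⟨y, hy, rfl⟩ _ ⟨z, hz, rfl⟩
    obtain ⟨w, hw, h₁, h₂⟩ := hdir y hy z hz
    exact ⟨_, ⟨w, hw, rfl⟩, monotone_of_nonneg hT h₁, monotone_of_nonneg hT h₂⟩
  · rintro _ ⟨y, hy, rfl⟩
    rw [IsSelfAdjoint, ← map_star_of_nonneg hT, (hsa y hy).star_eq]

theorem norm_le_of_star_mul_self_le {y : H →L[ℂ] H} {r : ℝ} (hr : 0 ≤ r)
    (h : star y * y ≤ ((r ^ 2 : ℝ) : ℂ) • (1 : H →L[ℂ] H)) : ‖y‖ ≤ r := by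
  have h' : star y * y ≤ algebraMap ℝ (H →L[ℂ] H) (r ^ 2) := by
    rw [Algebra.algebraMap_eq_smul_one]
    exact h.trans_eq (Complex.coe_smul (r ^ 2) (1 : H →L[ℂ] H))
  have := (CStarAlgebra.norm_le_iff_le_algebraMap _ (sq_nonneg r) (star_mul_self_nonneg y)).2 h'
  rw [CStarRing.norm_star_mul_self, ← sq] at this
  exact (sq_le_sq₀ (norm_nonneg _) hr).1 this

namespace IsFaithfulNormalTrace
variable {hZM : Z ≤ M}

section General
variable {L : Type*} [AddCommGroup L] [Module ℂ L] [Mul L] [PartialOrder L]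
  {π : Z →ₗ[ℂ] L} {Φ : M →ₗ[ℂ] L}

theorem apply_nonneg (hΦ : IsFaithfulNormalTrace hZM π Φ) {x : M} (hx : 0 ≤ x) : 0 ≤ Φ x := by
  obtain ⟨s, hs, rfl⟩ := exists_mul_self_of_nonneg hx
  simpa [(IsSelfAdjoint.of_nonneg hs).star_eq] using hΦ.nonneg s

/-- Polarization of the trace identity, at `x + y` and `x + i y`. -/
theorem apply_mul_comm (hΦ : IsFaithfulNormalTrace hZM π Φ) (x y : M) :
    Φ (x * y) = Φ (y * x) := by
  obtain ⟨x, rfl⟩ : ∃ z, star z = x := ⟨star x, star_star x⟩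
  have h₁ := hΦ.map_star_mul (x + y)
  have h₂ := hΦ.map_star_mul (x + Complex.I • y)
  have hx := hΦ.map_star_mul x
  have hy := hΦ.map_star_mul y
  simp only [star_add, star_smul, add_mul, mul_add, map_add, smul_mul_assoc, mul_smul_comm,
    map_smul, hx, hy, Complex.star_def, Complex.conj_I] at h₁ h₂
  have e₁ : Φ (star x * y) + Φ (star y * x) = Φ (y * star x) + Φ (x * star y) := by
    linear_combination (norm := module) h₁
  have e₂ : Complex.I • Φ (star x * y) - Complex.I • Φ (star y * x) =
      Complex.I • Φ (y * star x) - Complex.I • Φ (x * star y) := by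
    linear_combination (norm := module) h₂
  rw [← smul_sub, ← smul_sub] at e₂
  have e₃ := smul_right_injective L Complex.I_ne_zero e₂
  have e₄ : (2 : ℂ) • Φ (star x * y) = (2 : ℂ) • Φ (y * star x) := by
    rw [two_smul, two_smul]
    linear_combination (norm := module) e₁ + e₃
  exact smul_right_injective L two_ne_zero e₄

end General

variable {Φ : M →ₗ[ℂ] Z}

/-- The positive functional `x ↦ ⟪ξ, Φ x ξ⟫`. -/
noncomputable def vectorFunctional (Φ : M →ₗ[ℂ] Z) (ξ : H) : M →ₗ[ℂ] ℂ where
  toFun x := inner ℂ ξ ((Φ x : H →L[ℂ] H) ξ)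
  map_add' x y := by rw [map_add, ← inner_add_right]; rfl
  map_smul' c x := by rw [map_smul, RingHom.id_apply, smul_eq_mul, ← inner_smul_right]; rfl

theorem vectorFunctional_apply (ξ : H) (x : M) :
    vectorFunctional Φ ξ x = inner ℂ ξ ((Φ x : H →L[ℂ] H) ξ) := rfl

theorem vectorFunctional_nonneg (hΦ : IsFaithfulNormalTrace hZM LinearMap.id Φ) (ξ : H) {x : M}
    (hx : 0 ≤ x) : 0 ≤ vectorFunctional Φ ξ x :=
  ((ContinuousLinearMap.nonneg_iff_isPositive _).1
    (show (0 : H →L[ℂ] H) ≤ Φ x from hΦ.apply_nonneg hx)).inner_nonneg_right ξ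

theorem isWeaklyContinuous_vectorFunctional (hΦ : IsFaithfulNormalTrace hZM LinearMap.id Φ)
    (ξ : H) : IsWeaklyContinuous (vectorFunctional Φ ξ) := by
  refine isWeaklyContinuous_of_isNormalMap (fun x => hΦ.vectorFunctional_nonneg ξ)
    fun D x hne hdir hsa hx => ?_
  obtain ⟨hdir', hsa'⟩ := directedOn_image_and_isSelfAdjoint
    (fun x => hΦ.apply_nonneg) hdir hsa
  have h := (isLUB_image_coe (hne.image _) hdir' hsa' (hΦ.normal D x hne hdir hsa hx)).2 ξ
  rw [Set.image_image] at h
  have e (y : M) : (vectorFunctional Φ ξ y).re = (Φ y : H →L[ℂ] H).reApplyInnerSelf ξ :=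
    inner_re_symm (𝕜 := ℂ) _ _
  simpa only [e] using h

theorem exists_apply_sub_mul_eq_zero_of_mem (hΦ : IsFaithfulNormalTrace hZM LinearMap.id Φ)
    (hNM : N ≤ M) (hZN : Z ≤ N) {x : M} (hx0 : 0 ≤ x) (hx1 : x ≤ 1) (s : Finset H) :
    ∃ b : N, 0 ≤ b ∧ b ≤ 1 ∧ ∀ c : N, ∀ ξ ∈ s,
      (Φ ((x - incl hNM b) * incl hNM c) : H →L[ℂ] H) ξ = 0 := by
  set τ := ∑ ξ ∈ s, vectorFunctional Φ ξ with hτ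
  obtain ⟨b, hb0, hb1, hb⟩ := exists_forall_apply_sub_mul_eq_zero (τ := τ)
    (fun y hy => by
      rw [hτ, LinearMap.sum_apply]
      exact Finset.sum_nonneg fun ξ _ => hΦ.vectorFunctional_nonneg ξ hy)
    (fun y z => by
      simp only [hτ, LinearMap.sum_apply, vectorFunctional_apply, hΦ.apply_mul_comm y z])
    (.sum s fun ξ _ => hΦ.isWeaklyContinuous_vectorFunctional ξ) hNM hx0 hx1
  refine ⟨b, hb0, hb1, fun c ξ hξ => ?_⟩
  set d := Φ ((x - incl hNM b) * incl hNM c) with hd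
  -- By `Z`-linearity `star d` leaves the trace, and the equation becomes `∑ ‖d ξ‖ ^ 2 = 0`.
  have h := hb (c * incl hZN (star d))
  have hval : Φ ((x - incl hNM b) * incl hNM (c * incl hZN (star d))) = star d * d := by
    rw [incl_mul, ← mul_assoc, hΦ.apply_mul_comm]
    exact hΦ.map_central_mul (star d) _
  have hinner (η : H) : inner ℂ η (((star d * d : Z) : H →L[ℂ] H) η) =
      ((‖(d : H →L[ℂ] H) η‖ ^ 2 : ℝ) : ℂ) := by
    have e : ((star d * d : Z) : H →L[ℂ] H) η =
      ContinuousLinearMap.adjoint (d : H →L[ℂ] H) ((d : H →L[ℂ] H) η) := rfl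
    rw [e, ContinuousLinearMap.adjoint_inner_right, inner_self_eq_norm_sq_to_K]
    simp
  simp only [hτ, LinearMap.sum_apply, vectorFunctional_apply, hval, hinner] at h
  rw [← Complex.ofReal_sum, Complex.ofReal_eq_zero,
    Finset.sum_eq_zero_iff_of_nonneg fun _ _ => by positivity] at h
  simpa using h ξ hξ

theorem exists_nonneg_apply_sub_mul_eq_zero (hΦ : IsFaithfulNormalTrace hZM LinearMap.id Φ)
    (hNM : N ≤ M) (hZN : Z ≤ N) {x : M} (hx0 : 0 ≤ x) :
    ∃ b : N, 0 ≤ b ∧ ∀ c : N, Φ ((x - incl hNM b) * incl hNM c) = 0 := by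
  wlog hx1 : x ≤ 1 generalizing x
  · set r : ℝ := ‖(x : H →L[ℂ] H)‖ + 1
    have hr : 0 < r := by positivity
    have hr' : (0 : ℂ) ≤ (r⁻¹ : ℝ) := by exact_mod_cast (inv_pos.2 hr).le
    have hx' : 0 ≤ ((r⁻¹ : ℝ) : ℂ) • x := smul_nonneg hr' hx0
    obtain ⟨b, hb0, hb⟩ := this hx' <|
      (CStarAlgebra.norm_le_one_iff_of_nonneg (((r⁻¹ : ℝ) : ℂ) • (x : H →L[ℂ] H)) hx').1 <| by
        rw [norm_smul, Complex.norm_real, Real.norm_of_nonneg (inv_pos.2 hr).le]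
        exact (inv_mul_le_one₀ hr).2 (by simp [r])
    refine ⟨(r : ℂ) • b, smul_nonneg (by exact_mod_cast hr.le) hb0, fun c => ?_⟩
    have e : x - incl hNM ((r : ℂ) • b) = (r : ℂ) • (((r⁻¹ : ℝ) : ℂ) • x - incl hNM b) := by
      rw [smul_sub, smul_smul, ← Complex.ofReal_mul, mul_inv_cancel₀ hr.ne', incl_smul]
      simp
    rw [e, smul_mul_assoc, map_smul, hb, smul_zero]
  choose b hb0 hb1 hb using hΦ.exists_apply_sub_mul_eq_zero_of_mem hNM hZN hx0 hx1
  let U : Ultrafilter (Finset H) := Ultrafilter.of atTop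
  have hU : (U : Filter (Finset H)) ≤ atTop := Ultrafilter.of_le _
  have hC (s : Finset H) : ‖(b s : H →L[ℂ] H)‖ ≤ 1 := norm_le_one_of_nonneg (hb0 s) (hb1 s)
  obtain ⟨b', hb'⟩ := exists_weakTendsto U (fun s => (b s : H →L[ℂ] H)) (.of_forall hC)
  obtain ⟨b₀, rfl⟩ : ∃ b₀ : N, (b₀ : H →L[ℂ] H) = b' := ⟨⟨b', hb'.mem fun s => (b s).2⟩, rfl⟩
  refine ⟨b₀, hb'.ge_of_eventually_ge
    (fun s => IsSelfAdjoint.of_nonneg (R := H →L[ℂ] H) (hb0 s)) (.zero _) (.of_forall hb0),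
    fun c => ?_⟩
  have hz : (Φ ((x - incl hNM b₀) * incl hNM c) : H →L[ℂ] H).toLinearMap = 0 := by
    refine (inner_map_self_eq_zero _).1 fun ξ => ?_
    rw [← inner_conj_symm, map_eq_zero]
    have h := ((hΦ.isWeaklyContinuous_vectorFunctional ξ).comp_mulRight (incl hNM c)).tendsto
      (g := fun s => incl hNM (b s)) (b := incl hNM b₀) (.of_forall hC) hb'
    have h' := h.const_sub (vectorFunctional Φ ξ (x * incl hNM c))
    simp only [LinearMap.comp_apply, LinearMap.mulRight_apply, ← map_sub, ← sub_mul] at h'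
    refine tendsto_nhds_unique h' (tendsto_const_nhds.congr' ?_)
    -- Once `s` contains `ξ`, the functional vanishes exactly, so its limit is zero.
    filter_upwards [hU (eventually_ge_atTop {ξ})] with s hs
    rw [vectorFunctional_apply, hb s c ξ (Finset.singleton_subset_iff.1 hs), inner_zero_right]
  exact Subtype.ext (ContinuousLinearMap.coe_injective hz)

theorem exists_apply_sub_mul_eq_zero (hΦ : IsFaithfulNormalTrace hZM LinearMap.id Φ)
    (hNM : N ≤ M) (hZN : Z ≤ N) (x : M) :
    ∃ b : N, ∀ c : N, Φ ((x - incl hNM b) * incl hNM c) = 0 := by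
  have hx : x ∈ Submodule.span ℂ {a : M | 0 ≤ a} := by
    rw [CStarAlgebra.span_nonneg]; trivial
  induction hx using Submodule.span_induction with
  | mem x hx =>
    obtain ⟨b, -, hb⟩ := hΦ.exists_nonneg_apply_sub_mul_eq_zero hNM hZN hx
    exact ⟨b, hb⟩
  | zero => exact ⟨0, fun c => by rw [incl_zero, sub_zero, zero_mul, map_zero]⟩
  | add x y _ _ hx hy =>
    obtain ⟨a, ha⟩ := hx
    obtain ⟨b, hb⟩ := hy
    exact ⟨a + b, fun c => by
      rw [incl_add, add_sub_add_comm, add_mul, map_add, ha, hb, add_zero]⟩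
  | smul z x _ hx =>
    obtain ⟨a, ha⟩ := hx
    exact ⟨z • a, fun c => by
      rw [incl_smul, ← smul_sub, smul_mul_assoc, map_smul, ha, smul_zero]⟩

/-- Subtract the two equations at `c = star (b - a)` and use faithfulness. -/
theorem eq_of_apply_sub_mul_eq_zero (hΦ : IsFaithfulNormalTrace hZM LinearMap.id Φ)
    (hNM : N ≤ M) {x : M} {a b : N} (ha : ∀ c : N, Φ ((x - incl hNM a) * incl hNM c) = 0)
    (hb : ∀ c : N, Φ ((x - incl hNM b) * incl hNM c) = 0) : a = b := by
  have h : Φ (star (star (incl hNM (b - a))) * star (incl hNM (b - a))) = 0 := by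
    rw [star_star, ← incl_star]
    have := sub_eq_zero.2 ((ha (star (b - a))).trans (hb (star (b - a))).symm)
    rwa [← map_sub, ← sub_mul, sub_sub_sub_cancel_left, ← incl_sub] at this
  have h' := incl_injective hNM (star_eq_zero.1 (hΦ.faithful _ h) |>.trans (incl_zero hNM).symm)
  exact (sub_eq_zero.1 h').symm

theorem exists_isConditionalExpectation (hΦ : IsFaithfulNormalTrace hZM LinearMap.id Φ)
    (hNM : N ≤ M) (hZN : Z ≤ N) : ∃ E : M →ₗ[ℂ] N, IsConditionalExpectation hNM Φ E := by
  choose e he using hΦ.exists_apply_sub_mul_eq_zero hNM hZN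
  have huniq {x : M} {b : N} (hb : ∀ c : N, Φ ((x - incl hNM b) * incl hNM c) = 0) : e x = b :=
    hΦ.eq_of_apply_sub_mul_eq_zero hNM (he x) hb
  let E : M →ₗ[ℂ] N :=
    { toFun := e
      map_add' := fun x y => huniq fun c => by
        rw [incl_add, add_sub_add_comm, add_mul, map_add, he, he, add_zero]
      map_smul' := fun z x => huniq fun c => by
        rw [RingHom.id_apply, incl_smul, ← smul_sub, smul_mul_assoc, map_smul, he, smul_zero] }
  have hnonneg (x : M) (hx : 0 ≤ x) : 0 ≤ E x := by
    obtain ⟨b, hb0, hb⟩ := hΦ.exists_nonneg_apply_sub_mul_eq_zero hNM hZN hx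
    exact hb0.trans_eq (huniq hb).symm
  have hbimod (a b : N) (x : M) : E (incl hNM a * x * incl hNM b) = a * E x * b :=
    huniq fun c => by
      rw [incl_mul, incl_mul, ← sub_mul, ← mul_sub, mul_assoc, mul_assoc, hΦ.apply_mul_comm,
        mul_assoc, ← incl_mul, ← incl_mul]
      exact he x _
  have hright (x : M) (b : N) : E (x * incl hNM b) = E x * b := by
    simpa [incl_one] using hbimod 1 b x
  have hleft (x : M) (a : N) : E (incl hNM a * x) = a * E x := by
    simpa [incl_one] using hbimod a 1 x
  have hproj (a : N) : E (incl hNM a) = a := huniq fun c => by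
    rw [sub_self, zero_mul, map_zero]
  have htrace (x : M) : Φ (incl hNM (E x)) = Φ x := by
    have := he x 1
    rw [incl_one, mul_one, map_sub, sub_eq_zero] at this
    exact this.symm
  refine ⟨E, fun D x hne hdir hsa hx => ?_, hnonneg, fun x => ?_, fun a => ⟨_, hproj a⟩, hbimod,
    htrace⟩
  -- Normality: let `b ≤ E x` be the supremum of `E '' D`. It is also the supremum in `M`, so
  -- normality and invariance of `Φ` give `Φ b = Φ x = Φ (E x)`, and faithfulness forces `b = E x`.
  · obtain ⟨hdir', hsa'⟩ := directedOn_image_and_isSelfAdjoint hnonneg hdir hsa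
    have hub : E x ∈ upperBounds (E '' D) := by
      rintro _ ⟨y, hy, rfl⟩
      exact monotone_of_nonneg hnonneg (hx.1 hy)
    obtain ⟨b, hb, hbH, -⟩ := exists_isLUB (hne.image E) hdir' hsa' ⟨_, hub⟩
    have hbM : IsLUB (incl hNM '' (E '' D)) (incl hNM b) :=
      ⟨fun _ ⟨y, hy, h⟩ => h ▸ hb.1 hy,
        fun u hu => hbH.2 (by rintro _ ⟨y, hy, rfl⟩; exact hu ⟨y, hy, rfl⟩)⟩
    have h₁ := hΦ.normal _ _ ((hne.image E).image _)
      (by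
        rintro _ ⟨y, hy, rfl⟩ _ ⟨z, hz, rfl⟩
        obtain ⟨w, hw, h₁, h₂⟩ := hdir' y hy z hz
        exact ⟨_, ⟨w, hw, rfl⟩, h₁, h₂⟩)
      (by rintro _ ⟨y, hy, rfl⟩; exact congrArg (incl hNM) (hsa' y hy)) hbM
    simp only [Set.image_image, htrace] at h₁
    have h₂ := (hΦ.normal D x hne hdir hsa hx).unique h₁
    obtain ⟨s, hs, hss⟩ := exists_mul_self_of_nonneg (sub_nonneg.2 (hb.2 hub))
    have h₃ : incl hNM s = 0 := hΦ.faithful _ <| by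
      rw [← incl_star, (IsSelfAdjoint.of_nonneg hs).star_eq, ← incl_mul, hss, incl_sub, map_sub,
        htrace, h₂, sub_self]
    obtain rfl : s = 0 := incl_injective hNM h₃
    rw [mul_zero, eq_comm, sub_eq_zero] at hss
    rwa [hss]
  -- Kadison–Schwarz: positivity of `E` on the square of `x - E x` gives `star (E x) * E x ≤ E (star
  -- x * x)`.
  · have hsq : star (E x) * E x ≤ ((‖x‖ ^ 2 : ℝ) : ℂ) • (1 : N) := by
      have h₁ : 0 ≤ E (star (x - incl hNM (E x)) * (x - incl hNM (E x))) :=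
        hnonneg _ (star_mul_self_nonneg _)
      rw [star_sub, sub_mul, mul_sub, mul_sub, map_sub, map_sub, map_sub, ← incl_star, hright,
        hleft, ← incl_mul, hproj, map_star_of_nonneg hnonneg, sub_self, sub_zero, sub_nonneg] at h₁
      refine h₁.trans ?_
      have h₂ := monotone_of_nonneg hnonneg (mul_star_le_norm_sq (star x))
      rwa [star_star, show ‖star x‖ = ‖x‖ from norm_star (x : H →L[ℂ] H), map_smul,
        ← incl_one hNM, hproj] at h₂
    exact norm_le_of_star_mul_self_le (norm_nonneg _) hsq

theorem existsUnique_isConditionalExpectation (hΦ : IsFaithfulNormalTrace hZM LinearMap.id Φ)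
    (hNM : N ≤ M) (hZN : Z ≤ N) : ∃! E : M →ₗ[ℂ] N, IsConditionalExpectation hNM Φ E := by
  have key {E : M →ₗ[ℂ] N} (hE : IsConditionalExpectation hNM Φ E) (x : M) (c : N) :
      Φ ((x - incl hNM (E x)) * incl hNM c) = 0 := by
    have h := hE.bimodular 1 c x
    rw [incl_one, one_mul, one_mul] at h
    rw [sub_mul, map_sub, ← incl_mul, ← h, hE.trace_preserving, sub_self]
  obtain ⟨E, hE⟩ := hΦ.exists_isConditionalExpectation hNM hZN
  exact ⟨E, hE, fun F hF => LinearMap.ext fun x =>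
    hΦ.eq_of_apply_sub_mul_eq_zero hNM (key hF x) (key hE x)⟩

end IsFaithfulNormalTrace
end ConditionalExpectation
end VonNeumannAlgebra

/-! ### Traces with measurable functions as values -/

namespace VonNeumannAlgebra
section MeasurableFunctions
variable {Ω : Type*} [MeasurableSpace Ω] {m : Measure Ω}

theorem aeEqFun_nonneg_iff {f : Ω →ₘ[m] ℂ} : 0 ≤ f ↔ ∀ᵐ ω ∂m, 0 ≤ f ω := by
  rw [← AEEqFun.coeFn_le]
  refine Filter.eventually_congr ?_
  filter_upwards [AEEqFun.coeFn_zero (α := Ω) (μ := m) (β := ℂ)] with ω h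
  rw [h, Pi.zero_apply]

theorem aeEqFun_sub_nonneg {f g : Ω →ₘ[m] ℂ} : 0 ≤ f - g ↔ g ≤ f := by
  rw [aeEqFun_nonneg_iff, ← AEEqFun.coeFn_le]
  refine Filter.eventually_congr ?_
  filter_upwards [AEEqFun.coeFn_sub f g] with ω h
  rw [h, Pi.sub_apply, sub_nonneg]

theorem aeEqFun_mul_add (f g h : Ω →ₘ[m] ℂ) : f * (g + h) = f * g + f * h := by
  refine AEEqFun.ext ?_
  filter_upwards [AEEqFun.coeFn_mul f (g + h), AEEqFun.coeFn_add g h, AEEqFun.coeFn_mul f g,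
    AEEqFun.coeFn_mul f h, AEEqFun.coeFn_add (f * g) (f * h)] with ω h₁ h₂ h₃ h₄ h₅
  simp only [h₁, h₂, h₃, h₄, h₅, Pi.mul_apply, Pi.add_apply, mul_add]

theorem aeEqFun_mul_smul (c : ℂ) (f g : Ω →ₘ[m] ℂ) : f * (c • g) = c • (f * g) := by
  refine AEEqFun.ext ?_
  filter_upwards [AEEqFun.coeFn_mul f (c • g), AEEqFun.coeFn_smul c g, AEEqFun.coeFn_mul f g,
    AEEqFun.coeFn_smul c (f * g)] with ω h₁ h₂ h₃ h₄
  simp only [h₁, h₂, h₃, h₄, Pi.mul_apply, Pi.smul_apply, smul_eq_mul, mul_left_comm]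

theorem aeEqFun_mul_le_mul_left {f g h : Ω →ₘ[m] ℂ} (hf : 0 ≤ f) (hgh : g ≤ h) :
    f * g ≤ f * h := by
  rw [← AEEqFun.coeFn_le] at hgh ⊢
  filter_upwards [aeEqFun_nonneg_iff.1 hf, hgh, AEEqFun.coeFn_mul f g, AEEqFun.coeFn_mul f h]
    with ω h₁ h₂ h₃ h₄
  rw [h₃, h₄]
  exact mul_le_mul_of_nonneg_left h₂ h₁

/-- Every measurable function can be multiplied into the bounded functions by an invertible
positive weight. -/
theorem exists_weight (f : Ω →ₘ[m] ℂ) :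
    ∃ w v : Ω →ₘ[m] ℂ, w * v = 1 ∧ 0 ≤ w ∧ 0 ≤ v ∧
      ∀ᵐ ω ∂m, ‖w ω‖ * ‖f ω‖ ≤ 1 := by
  -- The weights are `w = 1 / (1 + |f|)` and `v = 1 + |f|`.
  have hpos (z : ℂ) : 0 < 1 + ‖z‖ := by positivity
  have hv : Continuous fun z : ℂ => ((1 + ‖z‖ : ℝ) : ℂ) := by fun_prop
  have hw : Continuous fun z : ℂ => (((1 + ‖z‖)⁻¹ : ℝ) : ℂ) :=
    Complex.continuous_ofReal.comp
      (Continuous.inv₀ (by fun_prop) fun z => (hpos z).ne')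
  refine ⟨AEEqFun.comp _ hw f, AEEqFun.comp _ hv f, AEEqFun.ext ?_, aeEqFun_nonneg_iff.2 ?_,
    aeEqFun_nonneg_iff.2 ?_, ?_⟩
  · filter_upwards [AEEqFun.coeFn_mul (AEEqFun.comp _ hw f) (AEEqFun.comp _ hv f),
      AEEqFun.coeFn_comp _ hw f, AEEqFun.coeFn_comp _ hv f,
      AEEqFun.coeFn_one (α := Ω) (μ := m) (β := ℂ)] with ω h₁ h₂ h₃ h₄
    rw [h₁, h₄, Pi.mul_apply, h₂, h₃]
    simp only [Function.comp]
    rw [← Complex.ofReal_mul, inv_mul_cancel₀ (hpos _).ne', Complex.ofReal_one, Pi.one_apply]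
  · filter_upwards [AEEqFun.coeFn_comp _ hw f] with ω h
    rw [h, Function.comp]
    exact_mod_cast (inv_pos.2 (hpos _)).le
  · filter_upwards [AEEqFun.coeFn_comp _ hv f] with ω h
    rw [h, Function.comp]
    exact_mod_cast (hpos _).le
  · filter_upwards [AEEqFun.coeFn_comp _ hw f] with ω h
    rw [h, Function.comp, Complex.norm_real, Real.norm_of_nonneg (inv_pos.2 (hpos _)).le]
    exact (inv_mul_le_one₀ (hpos _)).2 (by linarith)

end MeasurableFunctions

variable {H : Type*} [NormedAddCommGroup H] [InnerProductSpace ℂ H] [CompleteSpace H]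
  {M N Z : VonNeumannAlgebra H} {Ω : Type*} [MeasurableSpace Ω] {m : Measure Ω}
  {π : Z →ₗ[ℂ] (Ω →ₘ[m] ℂ)}

namespace IsLInftyIdentification

theorem exists_eq_of_ae_norm_le (hπ : IsLInftyIdentification π) {f : Ω →ₘ[m] ℂ} {C : ℝ}
    (hf : ∀ᵐ ω ∂m, ‖f ω‖ ≤ C) : ∃ a, π a = f :=
  (hπ.mem_range_iff f).2 (by
    rw [eLpNorm_exponent_top]
    exact eLpNormEssSup_lt_top_of_ae_bound hf)

theorem exists_ae_norm_le (hπ : IsLInftyIdentification π) (a : Z) :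
    ∃ C : ℝ, ∀ᵐ ω ∂m, ‖π a ω‖ ≤ C := by
  have h := (hπ.mem_range_iff (π a)).1 ⟨a, rfl⟩
  rw [eLpNorm_exponent_top] at h
  refine ⟨(eLpNormEssSup (π a) m).toReal, ?_⟩
  filter_upwards [ae_le_eLpNormEssSup (f := π a) (μ := m)] with ω hω
  simpa using ENNReal.toReal_mono h.ne hω

theorem map_star_mul_self_nonneg (hπ : IsLInftyIdentification π) (s : Z) :
    0 ≤ π (star s * s) := by
  rw [hπ.map_mul, hπ.map_star, aeEqFun_nonneg_iff]
  filter_upwards [AEEqFun.coeFn_mul (star (π s)) (π s), AEEqFun.coeFn_star (π s)] with ω h₁ h₂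
  rw [h₁, Pi.mul_apply, h₂, Pi.star_apply]
  exact star_mul_self_nonneg _

/-- The square root of a bounded function is bounded, hence comes from `Z`, so positivity on both
sides means being a square `star s * s`. -/
theorem map_nonneg_iff (hπ : IsLInftyIdentification π) {a : Z} : 0 ≤ π a ↔ 0 ≤ a := by
  refine ⟨fun h => ?_, fun h => ?_⟩
  · obtain ⟨C, hC⟩ := hπ.exists_ae_norm_le a
    have hg : Continuous fun z : ℂ => ((√z.re : ℝ) : ℂ) := by fun_prop
    have hcomp := AEEqFun.coeFn_comp _ hg (π a)
    obtain ⟨s, hs⟩ := hπ.exists_eq_of_ae_norm_le (f := AEEqFun.comp _ hg (π a)) (C := √C) (by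
      filter_upwards [hcomp, hC] with ω h₁ h₂
      rw [h₁, Function.comp, Complex.norm_real, Real.norm_of_nonneg (Real.sqrt_nonneg _)]
      exact Real.sqrt_le_sqrt ((Complex.re_le_norm _).trans h₂))
    have : star s * s = a := hπ.injective <| by
      rw [hπ.map_mul, hπ.map_star, hs]
      refine AEEqFun.ext ?_
      filter_upwards [AEEqFun.coeFn_mul (star (AEEqFun.comp _ hg (π a))) (AEEqFun.comp _ hg (π a)),
        AEEqFun.coeFn_star (AEEqFun.comp _ hg (π a)), hcomp, aeEqFun_nonneg_iff.1 h]
        with ω h₁ h₂ h₃ h₄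
      rw [h₁, Pi.mul_apply, h₂, Pi.star_apply, h₃]
      obtain ⟨hre, him⟩ := Complex.le_def.1 h₄
      simp only [Function.comp, Complex.star_def, Complex.conj_ofReal]
      rw [← Complex.ofReal_mul, Real.mul_self_sqrt hre]
      exact Complex.ext rfl him
    exact this ▸ star_mul_self_nonneg s
  · obtain ⟨s, hs, rfl⟩ := exists_mul_self_of_nonneg h
    simpa [(IsSelfAdjoint.of_nonneg hs).star_eq] using hπ.map_star_mul_self_nonneg s

theorem map_le_map_iff (hπ : IsLInftyIdentification π) {a b : Z} : π a ≤ π b ↔ a ≤ b := by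
  rw [← aeEqFun_sub_nonneg, ← map_sub, hπ.map_nonneg_iff, sub_nonneg]

end IsLInftyIdentification

namespace IsFaithfulNormalTrace
variable {hZM : Z ≤ M} {Φ : M →ₗ[ℂ] (Ω →ₘ[m] ℂ)}

/-- For `x ≥ 0`, `0 ≤ Φ x ≤ ‖x‖ • Φ 1`, so a weight that bounds `Φ 1` bounds `Φ x`; positive
elements span `M`. -/
theorem exists_map_eq_mul (hΦ : IsFaithfulNormalTrace hZM π Φ) (hπ : IsLInftyIdentification π)
    {w : Ω →ₘ[m] ℂ} (hw : ∀ᵐ ω ∂m, ‖w ω‖ * ‖Φ 1 ω‖ ≤ 1) (x : M) : ∃ a : Z, π a = w * Φ x := by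
  have hx : x ∈ Submodule.span ℂ {a : M | 0 ≤ a} := by
    rw [CStarAlgebra.span_nonneg]; trivial
  induction hx using Submodule.span_induction with
  | mem x hx =>
    refine hπ.exists_eq_of_ae_norm_le (C := ‖(x : H →L[ℂ] H)‖) ?_
    have hle : x ≤ ((‖(x : H →L[ℂ] H)‖ : ℝ) : ℂ) • (1 : M) := by
      refine (IsSelfAdjoint.le_algebraMap_norm_self (a := (x : H →L[ℂ] H))
        (IsSelfAdjoint.of_nonneg (R := H →L[ℂ] H) hx)).trans_eq ?_
      rw [Algebra.algebraMap_eq_smul_one]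
      exact (Complex.coe_smul _ (1 : H →L[ℂ] H)).symm
    have h := hΦ.apply_nonneg (sub_nonneg.2 hle)
    rw [map_sub, aeEqFun_sub_nonneg, map_smul, ← AEEqFun.coeFn_le] at h
    filter_upwards [h, aeEqFun_nonneg_iff.1 (hΦ.apply_nonneg hx), hw, AEEqFun.coeFn_mul w (Φ x),
      AEEqFun.coeFn_smul ((‖(x : H →L[ℂ] H)‖ : ℝ) : ℂ) (Φ 1)] with ω h₁ h₂ h₃ h₄ h₅
    have h₆ : ‖Φ x ω‖ ≤ ‖(x : H →L[ℂ] H)‖ * ‖Φ 1 ω‖ := by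
      have := CStarAlgebra.norm_le_norm_of_nonneg_of_le h₂ h₁
      rwa [h₅, Pi.smul_apply, norm_smul, Complex.norm_real, norm_norm] at this
    rw [h₄, Pi.mul_apply, norm_mul]
    calc ‖w ω‖ * ‖Φ x ω‖ ≤ ‖w ω‖ * (‖(x : H →L[ℂ] H)‖ * ‖Φ 1 ω‖) := by gcongr
      _ = ‖(x : H →L[ℂ] H)‖ * (‖w ω‖ * ‖Φ 1 ω‖) := by ring
      _ ≤ ‖(x : H →L[ℂ] H)‖ := mul_le_of_le_one_right (norm_nonneg _) h₃
  | zero =>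
    refine ⟨0, ?_⟩
    have h := aeEqFun_mul_add w 0 0
    rw [add_zero] at h
    rw [map_zero, map_zero]
    exact (left_eq_add.1 h).symm
  | add x y _ _ hx hy =>
    obtain ⟨a, ha⟩ := hx
    obtain ⟨b, hb⟩ := hy
    exact ⟨a + b, by rw [map_add, map_add, aeEqFun_mul_add, ha, hb]⟩
  | smul z x _ hx =>
    obtain ⟨a, ha⟩ := hx
    exact ⟨z • a, by rw [map_smul, map_smul, aeEqFun_mul_smul, ha]⟩

/-- A trace with measurable functions as values is, up to an invertible weight, a trace with values
in `Z`. -/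
theorem exists_isFaithfulNormalTrace_id (hΦ : IsFaithfulNormalTrace hZM π Φ)
    (hπ : IsLInftyIdentification π) :
    ∃ Ψ : M →ₗ[ℂ] Z, IsFaithfulNormalTrace hZM LinearMap.id Ψ ∧
      ∀ x y, Ψ x = Ψ y ↔ Φ x = Φ y := by
  obtain ⟨w, v, hwv, hw0, hv0, hw⟩ := exists_weight (Φ 1)
  choose e he using hΦ.exists_map_eq_mul hπ hw
  let Ψ : M →ₗ[ℂ] Z :=
    { toFun := e
      map_add' := fun x y => hπ.injective <| by
        rw [map_add, he, he, he, map_add, aeEqFun_mul_add]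
      map_smul' := fun z x => hπ.injective <| by
        rw [RingHom.id_apply, map_smul, he, he, map_smul, aeEqFun_mul_smul] }
  have hΨ (x : M) : π (Ψ x) = w * Φ x := he x
  have hvΨ (x : M) : v * π (Ψ x) = Φ x := by
    rw [hΨ, ← mul_assoc, mul_comm v, hwv, one_mul]
  have heq (x y : M) : Ψ x = Ψ y ↔ Φ x = Φ y :=
    ⟨fun h => by rw [← hvΨ x, h, hvΨ], fun h => hπ.injective (by rw [hΨ, hΨ, h])⟩
  have hle {x y : M} (h : Φ x ≤ Φ y) : Ψ x ≤ Ψ y := by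
    rw [← hπ.map_le_map_iff, hΨ, hΨ]
    exact aeEqFun_mul_le_mul_left hw0 h
  refine ⟨Ψ, ⟨fun z x => hπ.injective ?_, fun x => (heq _ _).2 (hΦ.map_star_mul x),
    fun x => ?_, fun x hx => hΦ.faithful x ?_,
    fun D x hne hdir hsa hx => ⟨?_, fun u hu => ?_⟩⟩, heq⟩
  · rw [hΨ, hΦ.map_central_mul, LinearMap.id_apply, hπ.map_mul, hΨ, mul_left_comm]
  · have h := hle (x := 0) (y := star x * x) (by rw [map_zero]; exact hΦ.nonneg x)
    rwa [map_zero] at h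
  · rw [← map_zero Ψ, heq, map_zero] at hx
    exact hx
  · rintro _ ⟨y, hy, rfl⟩
    exact hle ((hΦ.normal D x hne hdir hsa hx).1 ⟨y, hy, rfl⟩)
  -- An upper bound for `Ψ '' D` becomes one for `Φ '' D` through the inverse weight `v`, even if
  -- `v` is unbounded.
  · have h : Φ x ≤ v * π u := (hΦ.normal D x hne hdir hsa hx).2 <| by
      rintro _ ⟨y, hy, rfl⟩
      rw [← hvΨ]
      exact aeEqFun_mul_le_mul_left hv0 (hπ.map_le_map_iff.2 (hu ⟨y, hy, rfl⟩))
    rw [← hπ.map_le_map_iff, hΨ]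
    refine (aeEqFun_mul_le_mul_left hw0 h).trans_eq ?_
    rw [← mul_assoc, hwv, one_mul]

end IsFaithfulNormalTrace

end VonNeumannAlgebra

theorem mainTheorem5 {H : Type*} [NormedAddCommGroup H] [InnerProductSpace ℂ H] [CompleteSpace H]
    (M N Z : VonNeumannAlgebra H) (hM : M.IsFinite) (hNM : N ≤ M)
    (hZM : Z ≤ M) (hZcenter : Z ≤ M.commutant) (hZN : Z ≤ N) :
    (∀ Φ : M →ₗ[ℂ] Z,
      VonNeumannAlgebra.IsFaithfulNormalTrace hZM LinearMap.id Φ →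
      ∃! E : M →ₗ[ℂ] N, VonNeumannAlgebra.IsConditionalExpectation hNM Φ E) ∧
    (∀ {Ω : Type*} [MeasurableSpace Ω] (m : MeasureTheory.Measure Ω)
      (π : Z →ₗ[ℂ] (Ω →ₘ[m] ℂ)) (Φ : M →ₗ[ℂ] (Ω →ₘ[m] ℂ)),
      VonNeumannAlgebra.IsLInftyIdentification π →
      VonNeumannAlgebra.IsFaithfulNormalTrace hZM π Φ →
      ∃! E : M →ₗ[ℂ] N, VonNeumannAlgebra.IsConditionalExpectation hNM Φ E) := by
  refine ⟨fun Φ hΦ => hΦ.existsUnique_isConditionalExpectation hNM hZN, ?_⟩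
  intro Ω _ m π Φ hπ hΦ
  obtain ⟨Ψ, hΨ, heq⟩ := hΦ.exists_isFaithfulNormalTrace_id hπ
  -- The trace enters the conditions on `E` only through an equality of two of its values.
  have hiff (E : M →ₗ[ℂ] N) : VonNeumannAlgebra.IsConditionalExpectation hNM Ψ E ↔
      VonNeumannAlgebra.IsConditionalExpectation hNM Φ E :=
    ⟨fun h => { h with trace_preserving := fun x => (heq _ _).1 (h.trace_preserving x) },
      fun h => { h with trace_preserving := fun x => (heq _ _).2 (h.trace_preserving x) }⟩
  simpa only [hiff] using hΨ.existsUnique_isConditionalExpectation hNM hZN
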